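/- Let $k$ be a positive integer. A $k$-graph is a countable small category $\Lambda$ (paths; objects = identity morphisms = vertices; range $r$ and source $s$; $\lambda\mu$ is defined if $s(\lambda)=r(\mu)$) with a functor $d:\Lambda\to\mathbb N^k$ such that every $\lambda$ with $d(\lambda)=m+n$ is uniquely of the form $\mu\nu$ with $d(\mu)=m$, $d(\nu)=n$. Let $\Lambda^{\min}(\lambda,\mu)$ be the set of pairs $(\rho,\tau)$ with $\lambda\rho=\mu\tau$ and $d(\lambda\rho)=d(\lambda)\vee d(\mu)$; $\Lambda$ is finitely aligned if all these sets are finite. For a vertex $v$, a set $E\subseteq v\Lambda:=\{\lambda:r(\lambda)=v\}$ is exhaustive if for every $\lambda\in v\Lambda$ there is $\mu\in E$ with $\Lambda^{\min}(\lambda,\mu)\ne\emptyset$; $v\mathrm{FE}(\Lambda)$ is the set of finite exhaustive subsets of $v\Lambda\setminus\{v\}$. Let $\Lambda$ be a finitely aligned $k$-graph and $R$ a commutative ring with $1$. The Kumjian–Pask algebra $\mathrm{KP}_R(\Lambda)$ is the universal (not necessarily unital) $R$-algebra generated by elements $s_\lambda,s_{\mu^*}$ ($\lambda,\mu\in\Lambda$;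 $s_{v^*}=s_v$ for vertices $v$) such that (KP1) the $s_v$ are mutually orthogonal idempotents; (KP2) $s_\lambda s_\mu=s_{\lambda\mu}$ and $s_{\mu^*}s_{\lambda^*}=s_{(\lambda\mu)^*}$ if $s(\lambda)=r(\mu)$; (KP3) $s_{\lambda^*}s_\mu=\sum_{(\rho,\tau)\in\Lambda^{\min}(\lambda,\mu)}s_\rho s_{\tau^*}$; (KP4) $\prod_{\lambda\in E}(s_v-s_\lambda s_{\lambda^*})=0$ for all vertices $v$ and $E\in v\mathrm{FE}(\Lambda)$. For $m\in(\mathbb N\cup\{\infty\})^k$ let $\Omega_{k,m}$ be the category with objects $\{p\in\mathbb N^k:p\le m\}$ and a single morphism $(p,q)$, of range $p$, source $q$ and degree $q-p$, for all $p\le q\le m$. A boundary path is a degree-preserving functor $x:\Omega_{k,m}\to\Lambda$ (with $d(x):=m$) such that for all $n\in\mathbb N^k$ with $n\le m$ and all $E\in x(n,n)\mathrm{FE}(\Lambda)$ there is $\lambda\in E$ with $n+d(\lambda)\le m$ and $x(n,n+d(\lambda))=\lambda$. Let $\partial\Lambda$ be the set of boundary paths and, for $n\le d(x)$, $\sigma^nx(p,q)=x(n+p,n+q)$.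 The boundary-path groupoid $\mathcal G_\Lambda$ has object set $\partial\Lambda$ and as morphisms the triples $(x,m,y)\in\partial\Lambda\times\mathbb Z^k\times\partial\Lambda$ for which there are $p\le d(x)$, $q\le d(y)$ in $\mathbb N^k$ with $p-q=m$ and $\sigma^px=\sigma^qy$; range $x$, source $y$, $(x,m,y)(y,n,z)=(x,m+n,z)$, $(x,m,y)^{-1}=(y,-m,x)$. For $s(\lambda)=s(\mu)$ let $$Z(\lambda*_s\mu)=\{(x,d(\lambda)-d(\mu),y)\in\mathcal G_\Lambda: x(0,d(\lambda))=\lambda,\ y(0,d(\mu))=\mu,\ \sigma^{d(\lambda)}x=\sigma^{d(\mu)}y\}$$ (the conditions include $d(\lambda)\le d(x)$ and $d(\mu)\le d(y)$), and give $\mathcal G_\Lambda$ the topology generated by the sets $Z(\lambda*_s\mu\setminus G)=Z(\lambda*_s\mu)\setminus\bigcup_{\nu\in G}Z(\lambda\nu*_s\mu\nu)$ with $s(\lambda)=s(\mu)$ and $G\subseteq s(\lambda)\Lambda$ finite and not exhaustive. The Steinberg algebra $A_R(\mathcal G_\Lambda)$ is the $R$-module of locally constant functions $f:\mathcal G_\Lambda\to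 R$ with compact support, with the convolution $(f\star g)(a)=\sum_{r(b)=r(a)}f(b)g(b^{-1}a)$. Proposition. Convolution is well defined on $A_R(\mathcal G_\Lambda)$ (for $f,g\in A_R(\mathcal G_\Lambda)$ each of these sums has only finitely many nonzero terms, and $f\star g\in A_R(\mathcal G_\Lambda)$), and there is an isomorphism of $R$-algebras $\pi_T:\mathrm{KP}_R(\Lambda)\to A_R(\mathcal G_\Lambda)$ such that $\pi_T(s_\lambda)=1_{Z(\lambda*_ss(\lambda))}$ and $\pi_T(s_{\mu^*})=1_{Z(s(\mu)*_s\mu)}$ for all $\lambda,\mu\in\Lambda$. -/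

import Mathlib

open CategoryTheory

universe u v w

noncomputable section

/-! ### Higher-rank graphs -/

/-- A `k`-graph: a countable small category with a degree functor to `ℕ^k` (regarded as a category
with one object) having the factorisation property.
A morphism `f : v ⟶ w` has source `v` and range `w`, and the juxtaposition `λμ` of paths
(defined if `s(λ) = r(μ)`) is the composite `λ ∘ μ`, written `μ ≫ λ` in Mathlib. -/
structure KGraph (k : ℕ) where
  /-- the vertices -/
  Obj : Type u
  [cat : Category.{v} Obj]
  countable : Countable (Σ a b : Obj, (a ⟶ b))
  degree : ∀ {a b : Obj}, (a ⟶ b) → (Fin k → ℕ)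
  degree_id : ∀ a : Obj, degree (𝟙 a) = 0
  degree_comp : ∀ {a b c : Obj} (f : a ⟶ b) (g : b ⟶ c), degree (f ≫ g) = degree f + degree g
  factorisation : ∀ {a b : Obj} (f : a ⟶ b) (m n : Fin k → ℕ), degree f = m + n →
    ∃! p : Σ c : Obj, (c ⟶ b) × (a ⟶ c),
      p.2.2 ≫ p.2.1 = f ∧ degree p.2.1 = m ∧ degree p.2.2 = n

namespace KGraph

attribute [instance] KGraph.cat

variable {k : ℕ} (Λ : KGraph.{u, v} k)

/-- The elements of `Λ`, that is, the morphisms with their sources and ranges. -/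
structure Path where
  src : Λ.Obj
  rng : Λ.Obj
  hom : src ⟶ rng

variable {Λ}

/-- The degree `d(λ)`. -/
def Path.deg (l : Λ.Path) : Fin k → ℕ := Λ.degree l.hom

/-- The vertex `v`, as a path. -/
def vert (a : Λ.Obj) : Λ.Path := ⟨a, a, 𝟙 a⟩

/-- The path `λμ`, defined if `s(λ) = r(μ)`. -/
def Path.comp (l m : Λ.Path) (h : l.src = m.rng) : Λ.Path :=
  ⟨m.src, l.rng, m.hom ≫ eqToHom h.symm ≫ l.hom⟩

theorem Path.deg_vert (a : Λ.Obj) : (vert a).deg = 0 := Λ.degree_id a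

theorem Path.deg_comp (l m : Λ.Path) (h : l.src = m.rng) : (l.comp m h).deg = l.deg + m.deg := by
  obtain ⟨a, b, f⟩ := l
  obtain ⟨c, d, g⟩ := m
  obtain rfl : a = d := h
  simp [Path.deg, Path.comp, Λ.degree_comp, add_comm]

theorem Path.comp_assoc (l m n : Λ.Path) (h : l.src = m.rng) (h' : m.src = n.rng) :
    (l.comp m h).comp n h' = l.comp (m.comp n h') h := by
  simp [Path.comp]

theorem Path.comp_vert (l : Λ.Path) : l.comp (vert l.src) rfl = l := by
  simp [Path.comp, vert]

theorem Path.vert_comp (l : Λ.Path) : (vert l.rng).comp l rfl = l := by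
  simp [Path.comp, vert]

/-- `Λ^min(λ, μ)`: the pairs `(ρ, τ)` such that `λρ = μτ` is a minimal common extension of
`λ` and `μ`. -/
def minExt (l m : Λ.Path) : Set (Λ.Path × Λ.Path) :=
  {p | ∃ (h₁ : l.src = p.1.rng) (h₂ : m.src = p.2.rng),
    l.comp p.1 h₁ = m.comp p.2 h₂ ∧ (l.comp p.1 h₁).deg = l.deg ⊔ m.deg}

variable (Λ) in
/-- `Λ` is finitely aligned if all the sets `Λ^min(λ, μ)` are finite. -/
class FinitelyAligned : Prop where
  finite_minExt : ∀ l m : Λ.Path, (minExt l m).Finite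

/-- A set `E ⊆ vΛ` is exhaustive if every path in `vΛ` has a common extension with a member
of `E`. -/
def IsExhaustive (a : Λ.Obj) (E : Set Λ.Path) : Prop :=
  ∀ l : Λ.Path, l.rng = a → ∃ m ∈ E, (minExt l m).Nonempty

/-- `v FE(Λ)`: the finite exhaustive subsets of `vΛ \ {v}`. -/
def FE (a : Λ.Obj) : Set (Finset Λ.Path) :=
  {E | (∀ l ∈ E, l.rng = a ∧ l ≠ vert a) ∧ IsExhaustive a (E : Set Λ.Path)}

/-! ### Kumjian-Pask families -/

section Family

variable {R : Type w} [CommRing R] {A : Type*} [NonUnitalRing A]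

/-- The product `∏_{λ ∈ E} (S_v - S_λ S_{λ*})` along a list of elements of `vΛ`. The trailing
factor `S_v` does not change the product of a nonempty list when (KP1) and (KP2) hold, and it
makes sense of the product without a unit in `A`. -/
def gapProd (S T : Λ.Path → A) (a : Λ.Obj) (L : List Λ.Path) : A :=
  L.foldr (fun l x => (S (vert a) - S l * T l) * x) (S (vert a))

/-- Kumjian-Pask `Λ`-families in a (not necessarily unital) algebra; `S λ` and `T μ` stand for
`S_λ` and `S_{μ*}`, and `v* = v` for every vertex `v`. The relation (KP4) is imposed for every
order of the factors. -/
structure IsKPFamily [Λ.FinitelyAligned] (S T : Λ.Path → A) : Prop where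
  ghost_vert : ∀ a : Λ.Obj, T (vert a) = S (vert a)
  idem : ∀ a : Λ.Obj, S (vert a) * S (vert a) = S (vert a)
  orth : ∀ a b : Λ.Obj, a ≠ b → S (vert a) * S (vert b) = 0
  mul : ∀ (l m : Λ.Path) (h : l.src = m.rng), S l * S m = S (l.comp m h)
  ghost_mul : ∀ (l m : Λ.Path) (h : l.src = m.rng), T m * T l = T (l.comp m h)
  ghost_mul_path : ∀ l m : Λ.Path,
    T l * S m = ∑ p ∈ (FinitelyAligned.finite_minExt l m).toFinset, S p.1 * T p.2
  exhaustive : ∀ (a : Λ.Obj), ∀ E ∈ FE a, ∀ L : List Λ.Path, (L : Multiset Λ.Path) = E.val →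
    gapProd S T a L = 0

theorem map_gapProd {B F : Type*} [NonUnitalRing B] [FunLike F A B] [NonUnitalRingHomClass F A B]
    (φ : F) (S T : Λ.Path → A) (a : Λ.Obj) (L : List Λ.Path) :
    φ (gapProd S T a L) = gapProd (fun l => φ (S l)) (fun l => φ (T l)) a L := by
  induction L with
  | nil => rfl
  | cons l L ih =>
    simp only [gapProd, List.foldr_cons, map_mul, map_sub] at ih ⊢
    rw [ih]

end Family

/-! ### The Kumjian-Pask algebra -/

variable (Λ) in
/-- The letters: paths `λ` and ghost paths `μ*`. -/
inductive Letter
  | path (l : Λ.Path)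
  | ghost (m : Λ.Path)

variable (R : Type w) [CommRing R]

variable (Λ) in
/-- The free (non-unital) `R`-algebra on the letters: it has the nonempty words as a basis. -/
abbrev FreeAlg : Type _ := MonoidAlgebra R (FreeSemigroup Λ.Letter)

/-- A path as a word of length one. -/
def freePath (l : Λ.Path) : FreeAlg Λ R := MonoidAlgebra.single (FreeSemigroup.of (.path l)) 1

/-- A ghost path as a word of length one. -/
def freeGhost (m : Λ.Path) : FreeAlg Λ R := MonoidAlgebra.single (FreeSemigroup.of (.ghost m)) 1

variable (Λ) in
/-- The defining relations of the Kumjian-Pask algebra. -/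
inductive KPRel [Λ.FinitelyAligned] : FreeAlg Λ R → FreeAlg Λ R → Prop
  | ghost_vert (a : Λ.Obj) : KPRel (freeGhost R (vert a)) (freePath R (vert a))
  | idem (a : Λ.Obj) : KPRel (freePath R (vert a) * freePath R (vert a)) (freePath R (vert a))
  | orth (a b : Λ.Obj) (h : a ≠ b) : KPRel (freePath R (vert a) * freePath R (vert b)) 0
  | mul (l m : Λ.Path) (h : l.src = m.rng) :
      KPRel (freePath R l * freePath R m) (freePath R (l.comp m h))
  | ghost_mul (l m : Λ.Path) (h : l.src = m.rng) :
      KPRel (freeGhost R m * freeGhost R l) (freeGhost R (l.comp m h))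
  | ghost_mul_path (l m : Λ.Path) :
      KPRel (freeGhost R l * freePath R m)
        (∑ p ∈ (FinitelyAligned.finite_minExt l m).toFinset, freePath R p.1 * freeGhost R p.2)
  | exhaustive (a : Λ.Obj) (E : Finset Λ.Path) (hE : E ∈ FE a) (L : List Λ.Path)
      (hL : (L : Multiset Λ.Path) = E.val) : KPRel (gapProd (freePath R) (freeGhost R) a L) 0

variable (Λ) in
/-- The `R`-algebra congruence generated by the defining relations. -/
def kpCon [Λ.FinitelyAligned] : RingCon (FreeAlg Λ R) :=
  ringConGen fun x y => ∃ (r : R) (x' y' : FreeAlg Λ R),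
    KPRel Λ R x' y' ∧ x = r • x' ∧ y = r • y'

theorem kpCon_smul [Λ.FinitelyAligned] (r : R) {x y : FreeAlg Λ R} (h : kpCon Λ R x y) :
    kpCon Λ R (r • x) (r • y) := by
  have h' : RingConGen.Rel _ x y := h
  induction h' with
  | of x y hxy =>
    obtain ⟨s, x', y', hr, rfl, rfl⟩ := hxy
    exact RingConGen.Rel.of _ _ ⟨r * s, x', y', hr, by rw [mul_smul], by rw [mul_smul]⟩
  | refl x => exact (kpCon Λ R).refl _
  | symm hh ih => exact (kpCon Λ R).symm (ih hh)
  | trans h1 h2 ih1 ih2 => exact (kpCon Λ R).trans (ih1 h1) (ih2 h2)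
  | add h1 h2 ih1 ih2 =>
    rw [smul_add, smul_add]
    exact (kpCon Λ R).add (ih1 h1) (ih2 h2)
  | mul h1 h2 ih1 ih2 =>
    rw [← smul_mul_assoc, ← smul_mul_assoc]
    exact (kpCon Λ R).mul (ih1 h1) h2

variable (Λ) in
/-- The Kumjian-Pask algebra `KP_R(Λ)`: the free `R`-algebra on the paths and ghost paths modulo
the ideal generated by the Kumjian-Pask relations. -/
def KumjianPask [Λ.FinitelyAligned] : Type _ := (kpCon Λ R).Quotient

namespace KumjianPask

variable [Λ.FinitelyAligned]

instance : NonUnitalRing (KumjianPask Λ R) :=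
  inferInstanceAs (NonUnitalRing (kpCon Λ R).Quotient)

/-- The quotient map. -/
def mk : FreeAlg Λ R →ₙ+* KumjianPask Λ R where
  toFun x := Quotient.mk'' x
  map_mul' _ _ := rfl
  map_zero' := rfl
  map_add' _ _ := rfl

theorem mk_surjective : Function.Surjective (mk (Λ := Λ) R) := Quotient.mk''_surjective

theorem mk_eq_iff {x y : FreeAlg Λ R} : mk R x = mk R y ↔ kpCon Λ R x y := Quotient.eq''

instance : SMul R (KumjianPask Λ R) where
  smul r := Quotient.map' (fun x => r • x) fun _ _ h => kpCon_smul R r h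

theorem mk_smul (r : R) (x : FreeAlg Λ R) : mk R (r • x) = r • mk R x := rfl

instance : Module R (KumjianPask Λ R) :=
  Function.Surjective.module R (mk (Λ := Λ) R).toAddMonoidHom (mk_surjective R) (mk_smul R)

instance : IsScalarTower R (KumjianPask Λ R) (KumjianPask Λ R) where
  smul_assoc r x y := by
    obtain ⟨x, rfl⟩ := mk_surjective R x
    obtain ⟨y, rfl⟩ := mk_surjective R y
    simp only [smul_eq_mul, ← mk_smul, ← map_mul, smul_mul_assoc]

instance : SMulCommClass R (KumjianPask Λ R) (KumjianPask Λ R) where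
  smul_comm r x y := by
    obtain ⟨x, rfl⟩ := mk_surjective R x
    obtain ⟨y, rfl⟩ := mk_surjective R y
    simp only [smul_eq_mul, ← mk_smul, ← map_mul, mul_smul_comm]

/-- The generator `s_λ`. -/
def path (l : Λ.Path) : KumjianPask Λ R := mk R (freePath R l)

/-- The generator `s_{μ*}`. -/
def ghost (m : Λ.Path) : KumjianPask Λ R := mk R (freeGhost R m)

theorem mk_eq_of_rel {x y : FreeAlg Λ R} (h : KPRel Λ R x y) : mk R x = mk R y :=
  (mk_eq_iff R).2 (RingConGen.Rel.of _ _ ⟨1, x, y, h, (one_smul _ _).symm, (one_smul _ _).symm⟩)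

/-- The generators form a Kumjian-Pask family. -/
theorem isKPFamily : IsKPFamily (path (Λ := Λ) R) (ghost R) where
  ghost_vert a := mk_eq_of_rel R (.ghost_vert a)
  idem a := (map_mul (mk R) _ _).symm.trans (mk_eq_of_rel R (.idem a))
  orth a b h := (map_mul (mk R) _ _).symm.trans (mk_eq_of_rel R (.orth a b h))
  mul l m h := (map_mul (mk R) _ _).symm.trans (mk_eq_of_rel R (.mul l m h))
  ghost_mul l m h := (map_mul (mk R) _ _).symm.trans (mk_eq_of_rel R (.ghost_mul l m h))
  ghost_mul_path l m := by
    refine (map_mul (mk R) _ _).symm.trans ((mk_eq_of_rel R (.ghost_mul_path l m)).trans ?_)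
    rw [map_sum]
    exact Finset.sum_congr rfl fun p _ => map_mul (mk R) _ _
  exhaustive a E hE L hL := (map_gapProd (mk R) _ _ a L).symm.trans
    ((mk_eq_of_rel R (.exhaustive a E hE L hL)).trans (map_zero _))

/-- The universal property of the Kumjian-Pask algebra. -/
theorem existsUnique_lift {A : Type*} [NonUnitalRing A] [Module R A] [IsScalarTower R A A]
    [SMulCommClass R A A] (S T : Λ.Path → A) (h : IsKPFamily S T) :
    ∃! φ : KumjianPask Λ R →ₙₐ[R] A, (∀ l, φ (path R l) = S l) ∧ ∀ m, φ (ghost R m) = T m := by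
  let f : Λ.Letter → A := fun x => match x with
    | .path l => S l
    | .ghost m => T m
  let ψ : FreeAlg Λ R →ₙₐ[R] A := MonoidAlgebra.liftMagma R (FreeSemigroup.lift f)
  have hS : ∀ l, ψ (freePath R l) = S l := fun l => by
    simp [ψ, freePath, f, MonoidAlgebra.liftMagma]
  have hT : ∀ l, ψ (freeGhost R l) = T l := fun l => by
    simp [ψ, freeGhost, f, MonoidAlgebra.liftMagma]
  have hrel : ∀ x y, KPRel Λ R x y → ψ x = ψ y := by
    intro x y hxy
    cases hxy with
    | ghost_vert a => rw [hS, hT, h.ghost_vert]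
    | idem a => rw [map_mul, hS, h.idem]
    | orth a b hab => rw [map_mul, hS, hS, h.orth a b hab, map_zero]
    | mul l m hh => rw [map_mul, hS, hS, hS, h.mul l m hh]
    | ghost_mul l m hh => rw [map_mul, hT, hT, hT, h.ghost_mul l m hh]
    | ghost_mul_path l m =>
      rw [map_mul, hS, hT, h.ghost_mul_path, map_sum]
      exact Finset.sum_congr rfl fun p _ => by rw [map_mul, hS, hT]
    | exhaustive a E hE L hL =>
      rw [map_gapProd, map_zero, funext hS, funext hT, h.exhaustive a E hE L hL]
  have hcon : ∀ x y, kpCon Λ R x y → ψ x = ψ y := by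
    intro x y hxy
    have h' : RingConGen.Rel _ x y := hxy
    induction h' with
    | of x y hr =>
      obtain ⟨s, x', y', hr, rfl, rfl⟩ := hr
      rw [map_smul, map_smul, hrel _ _ hr]
    | refl x => rfl
    | symm hh ih => exact (ih hh).symm
    | trans h1 h2 ih1 ih2 => exact (ih1 h1).trans (ih2 h2)
    | add h1 h2 ih1 ih2 => rw [map_add, map_add, ih1 h1, ih2 h2]
    | mul h1 h2 ih1 ih2 => rw [map_mul, map_mul, ih1 h1, ih2 h2]
  let φ : KumjianPask Λ R →ₙₐ[R] A :=
    { toFun := fun x => Quotient.liftOn' x ψ hcon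
      map_smul' := fun r x => by
        obtain ⟨x, rfl⟩ := mk_surjective R x
        exact map_smul ψ r x
      map_zero' := map_zero ψ
      map_add' := fun x y => by
        obtain ⟨x, rfl⟩ := mk_surjective R x
        obtain ⟨y, rfl⟩ := mk_surjective R y
        exact map_add ψ x y
      map_mul' := fun x y => by
        obtain ⟨x, rfl⟩ := mk_surjective R x
        obtain ⟨y, rfl⟩ := mk_surjective R y
        exact map_mul ψ x y }
  refine ⟨φ, ⟨hS, hT⟩, ?_⟩
  rintro φ' ⟨hS', hT'⟩
  let q : FreeAlg Λ R →ₙₐ[R] KumjianPask Λ R :=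
    { mk (Λ := Λ) R with map_smul' := mk_smul R }
  have key : φ'.comp q = ψ := by
    refine (MonoidAlgebra.liftMagma R).symm.injective (FreeSemigroup.hom_ext (funext fun x => ?_))
    cases x with
    | path l => exact (hS' l).trans (hS l).symm
    | ghost m => exact (hT' m).trans (hT m).symm
  ext x
  obtain ⟨x, rfl⟩ := mk_surjective R x
  exact DFunLike.congr_fun key x

end KumjianPask

/-! ### Boundary paths -/

/-- `n ≤ m` for `n ∈ ℕ^k` and `m ∈ (ℕ ∪ {∞})^k`. -/
def Below (n : Fin k → ℕ) (m : Fin k → ℕ∞) : Prop := ∀ i, (n i : ℕ∞) ≤ m i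

theorem Below.mono {p q : Fin k → ℕ} {m : Fin k → ℕ∞} (hq : Below q m) (h : p ≤ q) : Below p m :=
  fun i => (Nat.cast_le.2 (h i)).trans (hq i)

theorem Below.add_of_sub {p n : Fin k → ℕ} {m : Fin k → ℕ∞} (hp : Below p m)
    (hn : Below n (fun i => m i - p i)) : Below (p + n) m := fun i => by
  have h := add_le_add_right (hn i) (p i : ℕ∞)
  rw [add_tsub_cancel_of_le (hp i)] at h
  simpa using h

theorem Below.sub_of_add {p n : Fin k → ℕ} {m : Fin k → ℕ∞} (h : Below (p + n) m) :
    Below n (fun i => m i - p i) := fun i => by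
  have h' := h i
  rw [Pi.add_apply, Nat.cast_add] at h'
  exact ENat.le_sub_of_add_le_left (ENat.natCast_ne_top _) h'

theorem Below.sup {p q : Fin k → ℕ} {m : Fin k → ℕ∞} (hp : Below p m) (hq : Below q m) :
    Below (p ⊔ q) m := fun i => by
  rcases le_total (p i) (q i) with h | h
  · rw [Pi.sup_apply, sup_eq_right.2 h]
    exact hq i
  · rw [Pi.sup_apply, sup_eq_left.2 h]
    exact hp i

variable (Λ) in
/-- Degree-preserving functors `x : Ω_{k,m} → Λ` with `m ∈ (ℕ ∪ {∞})^k`. Here `Ω_{k,m}` has the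
objects `p ∈ ℕ^k` with `p ≤ m`, and one morphism `(p, q)`, with range `p`, source `q` and degree
`q - p`, for all `p ≤ q ≤ m`. -/
structure OmegaPath where
  /-- the degree `d(x) = m` -/
  deg : Fin k → ℕ∞
  /-- the vertex `x(n)` -/
  obj : ∀ n : Fin k → ℕ, Below n deg → Λ.Obj
  /-- the path `x(p, q)` -/
  seg : ∀ p q : Fin k → ℕ, p ≤ q → Below q deg → Λ.Path
  rng_seg : ∀ p q (h : p ≤ q) (hq : Below q deg), (seg p q h hq).rng = obj p (hq.mono h)
  src_seg : ∀ p q (h : p ≤ q) (hq : Below q deg), (seg p q h hq).src = obj q hq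
  deg_seg : ∀ p q (h : p ≤ q) (hq : Below q deg), (seg p q h hq).deg = q - p
  seg_self : ∀ p (hp : Below p deg), seg p p le_rfl hp = vert (obj p hp)
  seg_comp : ∀ p q t (h : p ≤ q) (h' : q ≤ t) (ht : Below t deg),
    (seg p q h (ht.mono h')).comp (seg q t h' ht)
      ((src_seg p q h (ht.mono h')).trans (rng_seg q t h' ht).symm) = seg p t (h.trans h') ht

namespace OmegaPath

theorem ext' {x y : Λ.OmegaPath} (hd : x.deg = y.deg)
    (hs : ∀ p q (h : p ≤ q) (hx : Below q x.deg) (hy : Below q y.deg),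
      x.seg p q h hx = y.seg p q h hy) : x = y := by
  have ho : ∀ n (hx : Below n x.deg) (hy : Below n y.deg), x.obj n hx = y.obj n hy := by
    intro n hx hy
    rw [← x.rng_seg n n le_rfl hx, ← y.rng_seg n n le_rfl hy, hs n n le_rfl hx hy]
  obtain ⟨d, o, s, _, _, _, _, _⟩ := x
  obtain ⟨d', o', s', _, _, _, _, _⟩ := y
  obtain rfl : d = d' := hd
  obtain rfl : o = o' := funext fun n => funext fun hn => ho n hn hn
  obtain rfl : s = s' :=
    funext fun p => funext fun q => funext fun h => funext fun hq => hs p q h hq hq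
  rfl

theorem seg_congr (x : Λ.OmegaPath) {p q p' q' : Fin k → ℕ} (h : p ≤ q) (hq : Below q x.deg)
    (ep : p = p') (eq : q = q') (h' : p' ≤ q') (hq' : Below q' x.deg) :
    x.seg p q h hq = x.seg p' q' h' hq' := by
  subst ep eq
  rfl

/-- The shift `σ^p x`, with `d(σ^p x) = d(x) - p` and `(σ^p x)(m, n) = x(p + m, p + n)`. -/
def shift (x : Λ.OmegaPath) (p : Fin k → ℕ) (hp : Below p x.deg) : Λ.OmegaPath where
  deg := fun i => x.deg i - p i
  obj n hn := x.obj (p + n) (hp.add_of_sub hn)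
  seg m n h hn := x.seg (p + m) (p + n) (add_le_add_right h p) (hp.add_of_sub hn)
  rng_seg _ _ _ _ := x.rng_seg _ _ _ _
  src_seg _ _ _ _ := x.src_seg _ _ _ _
  deg_seg m n _ _ := by rw [x.deg_seg, add_tsub_add_eq_tsub_left]
  seg_self _ _ := x.seg_self _ _
  seg_comp _ _ _ _ _ _ := x.seg_comp _ _ _ _ _ _

theorem shift_shift (x : Λ.OmegaPath) (p q t : Fin k → ℕ) (ht : p + q = t) (hp : Below p x.deg)
    (hq : Below q (x.shift p hp).deg) (hpq : Below t x.deg) :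
    (x.shift p hp).shift q hq = x.shift t hpq := by
  subst ht
  refine ext' (funext fun i => ?_) fun m n h _ _ => ?_
  · simp [shift, tsub_add_eq_tsub_tsub]
  · exact x.seg_congr _ _ (add_assoc p q m).symm (add_assoc p q n).symm _ _

theorem shift_congr {x y : Λ.OmegaPath} (h : x = y) (p : Fin k → ℕ) (hx : Below p x.deg)
    (hy : Below p y.deg) : x.shift p hx = y.shift p hy := by
  subst h
  rfl

/-- If `σ^p x = σ^q y` then `σ^(p+t) x = σ^(q+t) y` for all `t` such that `q + t ≤ d(y)`. -/
theorem shift_add_eq {x y : Λ.OmegaPath} {p q : Fin k → ℕ} {hp : Below p x.deg}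
    {hq : Below q y.deg} (h : x.shift p hp = y.shift q hq) (t : Fin k → ℕ)
    (ht : Below (q + t) y.deg) :
    ∃ h' : Below (p + t) x.deg, x.shift (p + t) h' = y.shift (q + t) ht := by
  have h1 : Below t (y.shift q hq).deg := ht.sub_of_add
  have h2 : Below t (x.shift p hp).deg := h ▸ h1
  have h3 : Below (p + t) x.deg := hp.add_of_sub h2
  refine ⟨h3, ?_⟩
  rw [← x.shift_shift p t _ rfl hp h2 h3, ← y.shift_shift q t _ rfl hq h1 ht]
  exact shift_congr h t h2 h1

/-- `x` is a boundary path if, for all `n ≤ d(x)` and `E ∈ x(n) FE(Λ)`, some `λ ∈ E` satisfies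
`x(n, n + d(λ)) = λ`. -/
def IsBoundary (x : Λ.OmegaPath) : Prop :=
  ∀ (n : Fin k → ℕ) (hn : Below n x.deg), ∀ E ∈ FE (x.obj n hn),
    ∃ l ∈ E, ∃ h : Below (n + l.deg) x.deg, x.seg n (n + l.deg) le_self_add h = l

end OmegaPath

variable (Λ) in
/-- The boundary path space `∂Λ`. -/
def BoundaryPath : Type _ := {x : Λ.OmegaPath // x.IsBoundary}

/-! ### The boundary-path groupoid -/

/-- `(x, m, y)` belongs to the boundary-path groupoid: there are `p ≤ d(x)` and `q ≤ d(y)` with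
`p - q = m` and `σ^p x = σ^q y`. -/
def ShiftRel (x : Λ.BoundaryPath) (m : Fin k → ℤ) (y : Λ.BoundaryPath) : Prop :=
  ∃ (p q : Fin k → ℕ) (hp : Below p x.1.deg) (hq : Below q y.1.deg),
    (∀ i, m i = (p i : ℤ) - (q i : ℤ)) ∧ x.1.shift p hp = y.1.shift q hq

theorem ShiftRel.refl (x : Λ.BoundaryPath) : ShiftRel x 0 x :=
  ⟨0, 0, fun _ => by simp, fun _ => by simp, fun _ => by simp, rfl⟩

theorem ShiftRel.symm {x y : Λ.BoundaryPath} {m : Fin k → ℤ} (h : ShiftRel x m y) :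
    ShiftRel y (-m) x := by
  obtain ⟨p, q, hp, hq, hm, e⟩ := h
  exact ⟨q, p, hq, hp, fun i => by simp [hm i], e.symm⟩

theorem ShiftRel.trans {x y z : Λ.BoundaryPath} {m n : Fin k → ℤ} (h : ShiftRel x m y)
    (h' : ShiftRel y n z) : ShiftRel x (m + n) z := by
  obtain ⟨p, q, hp, hq, hm, e⟩ := h
  obtain ⟨p', q', hp', hq', hn, e'⟩ := h'
  have e1 : q + (q ⊔ p' - q) = q ⊔ p' := add_tsub_cancel_of_le le_sup_left
  have e2 : p' + (q ⊔ p' - p') = q ⊔ p' := add_tsub_cancel_of_le le_sup_right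
  have hs : Below (q ⊔ p') y.1.deg := hq.sup hp'
  obtain ⟨h1, s1⟩ := OmegaPath.shift_add_eq e (q ⊔ p' - q) (e1.symm ▸ hs)
  obtain ⟨h2, s2⟩ := OmegaPath.shift_add_eq e'.symm (q ⊔ p' - p') (e2.symm ▸ hs)
  refine ⟨_, _, h1, h2, fun i => ?_, s1.trans (Eq.trans ?_ s2.symm)⟩
  · have a1 := congrFun e1 i
    have a2 := congrFun e2 i
    simp only [Pi.add_apply, hm i, hn i] at a1 a2 ⊢
    push_cast
    omega
  · congr 1
    rw [e1, e2]

/-- The boundary-path groupoid `𝒢_Λ`: the objects are the boundary paths; a morphism with source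
`y` and range `x` is a triple `(x, m, y)`; the composite of `(x, m, y)` and `(y, n, z)` is
`(x, m + n, z)`, and the inverse of `(x, m, y)` is `(y, -m, x)`. -/
instance boundaryPathGroupoid : Groupoid Λ.BoundaryPath where
  Hom y x := {m : Fin k → ℤ // ShiftRel x m y}
  id x := ⟨0, ShiftRel.refl x⟩
  comp b a := ⟨a.1 + b.1, a.2.trans b.2⟩
  inv a := ⟨-a.1, a.2.symm⟩
  id_comp _ := Subtype.ext (add_zero _)
  comp_id _ := Subtype.ext (zero_add _)
  assoc _ _ _ := Subtype.ext (add_assoc _ _ _).symm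
  inv_comp _ := Subtype.ext (add_neg_cancel _)
  comp_inv _ := Subtype.ext (neg_add_cancel _)

end KGraph

/-! ### Steinberg algebras -/

section Steinberg

/-- The set of all morphisms of a groupoid. -/
structure GroupoidArrow (G : Type u) [Groupoid.{v} G] where
  src : G
  rng : G
  hom : src ⟶ rng

variable (G : Type u) [Groupoid.{v} G] (R : Type w) [CommRing R]

/-- The `R`-module `A_R(𝒢)` of the locally constant functions with compact support on the
morphisms of a (Hausdorff, ample) groupoid. -/
def steinbergAlgebra [TopologicalSpace (GroupoidArrow G)] :
    Submodule R (GroupoidArrow G → R) where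
  carrier := {f | IsLocallyConstant f ∧ HasCompactSupport f}
  add_mem' hf hg := ⟨hf.1.add hg.1, hf.2.add hg.2⟩
  zero_mem' := ⟨IsLocallyConstant.const 0, HasCompactSupport.zero⟩
  smul_mem' r _ hf := ⟨hf.1.comp (fun t => r • t), hf.2.comp_left (smul_zero r)⟩

variable {G R}

/-- The term `f(b) g(b⁻¹a)` of the convolution at `a`, for a morphism `b` with `r(b) = r(a)`. -/
def convTerm (f g : GroupoidArrow G → R) (a : GroupoidArrow G) (b : Σ t : G, (t ⟶ a.rng)) : R :=
  f ⟨b.1, a.rng, b.2⟩ * g ⟨a.src, b.1, a.hom ≫ Groupoid.inv b.2⟩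

/-- The convolution `(f ⋆ g)(a) = ∑_{r(b) = r(a)} f(b) g(b⁻¹a)`. -/
def convolution (f g : GroupoidArrow G → R) (a : GroupoidArrow G) : R :=
  ∑ᶠ b : Σ t : G, (t ⟶ a.rng), convTerm f g a b

end Steinberg

namespace KGraph

variable {k : ℕ} {Λ : KGraph.{u, v} k}

/-- `Z_Λ(λ *_s μ)`: the triples `(x, d(λ) - d(μ), y)` with `x ∈ λ∂Λ`, `y ∈ μ∂Λ` and
`σ^{d(λ)} x = σ^{d(μ)} y`, where `x ∈ λ∂Λ` means that `x(0, d(λ)) = λ`. -/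
def Z (l m : Λ.Path) : Set (GroupoidArrow Λ.BoundaryPath) :=
  {a | ∃ (hl : Below l.deg a.rng.1.deg) (hm : Below m.deg a.src.1.deg),
    a.rng.1.seg 0 l.deg zero_le hl = l ∧ a.src.1.seg 0 m.deg zero_le hm = m ∧
    (∀ i, a.hom.1 i = (l.deg i : ℤ) - (m.deg i : ℤ)) ∧
    a.rng.1.shift l.deg hl = a.src.1.shift m.deg hm}

/-- `Z_Λ(λ *_s μ \ G)`, which is `Z_Λ(λ *_s μ)` without the sets `Z_Λ(λν *_s μν)`, `ν ∈ G`. -/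
def ZDiff (l m : Λ.Path) (G : Set Λ.Path) : Set (GroupoidArrow Λ.BoundaryPath) :=
  Z l m \ ⋃ n ∈ G, {a | ∃ (h : l.src = n.rng) (h' : m.src = n.rng), a ∈ Z (l.comp n h) (m.comp n h')}

/-- The topology on the boundary-path groupoid with the basis `Z_Λ(λ *_s μ \ G)`, where
`s(λ) = s(μ)` and `G ⊆ s(λ)Λ` is finite and not exhaustive. -/
instance : TopologicalSpace (GroupoidArrow Λ.BoundaryPath) :=
  TopologicalSpace.generateFrom
    {U | ∃ (l m : Λ.Path) (G : Set Λ.Path), l.src = m.src ∧ G.Finite ∧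
      (∀ n ∈ G, n.rng = l.src) ∧ ¬ IsExhaustive l.src G ∧ U = ZDiff l m G}

end KGraph

end

noncomputable section

namespace KGraph

variable {k : ℕ} {Λ : KGraph.{u, v} k}

/-! ### The prefix order on paths -/

namespace Path

/-! The Kumjian-Pask algebra acts on all functions on `∂Λ × ℤ^k`: `s_λ` prepends `λ` to the boundary
path and adds `d(λ)` to the degree, and `s_{μ*}` undoes this. The relations hold pointwise
(`isKPFamily_op`), (KP4) being exactly the boundary condition. `toFun a` is the integral kernel of
the operator of `a`: its value at `(x, m, y)` is the value at `(x, m)` of the image of the point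
mass at `(y, 0)`. The factor `ℤ^k` keeps apart arrows with the same ends and different degrees. The
kernel of `s_λ s_{μ*}` is the indicator of `Z(λ *_s μ)` (`toFun_path_mul_ghost`), and these elements
span the algebra, so every operator is recovered from its kernel by a finite sum (`opHom_apply`).
Composition of operators is then convolution of kernels (`convTerm_toFun`). It remains to find the
null space and the range of `toFun`.

Injectivity (`toFun_injective`) uses a prime ideal. If `a ≠ 0`, the annihilator of `a` in the
commutative ring generated by the diagonal elements `s_λ s_{λ*}` lies in a prime `P`. The paths
whose diagonal element is outside `P` are the initial segments of a boundary path `x`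
(`exists_boundaryPath_of_isPrime`): (KP3) makes them directed and (KP4) gives the boundary
condition. Multiplying `a` by suitable elements outside `P` brings it to a form in which it is read
off from the values of `toFun a` at arrows with range `x`. If these vanish, an element outside `P`
kills `a`, a contradiction.

For the range (`range_toFun`), each `Z(λ *_s μ)` is open, closed and compact (`isCompact_Z`), so
kernels lie in the Steinberg algebra. Conversely, two such sets meet in a finite disjoint union of
sets of the same kind, so the range is closed under pointwise products (`mul_mem_range`). It
therefore contains the indicators of small neighbourhoods, and compactness of supports gives the
rest. Closure of the Steinberg algebra under convolution follows from these facts. -/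

theorem exists_factor (p : Λ.Path) {n : Fin k → ℕ} (hn : n ≤ p.deg) :
    ∃ (l t : Λ.Path) (e : l.src = t.rng), l.comp t e = p ∧ l.deg = n := by
  obtain ⟨a, b, f⟩ := p
  obtain ⟨⟨c, g, h⟩, ⟨h1, h2, -⟩, -⟩ :=
    Λ.factorisation f n (Λ.degree f - n) (add_tsub_cancel_of_le hn).symm
  refine ⟨⟨c, b, g⟩, ⟨a, c, h⟩, rfl, ?_, h2⟩
  simpa [comp] using h1

/-- Uniqueness of factorisations. The degrees of the right factors agree by cancellation, and
equality of the intermediate vertices is part of the conclusion. -/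
theorem comp_inj {l t l' t' : Λ.Path} {e : l.src = t.rng} {e' : l'.src = t'.rng}
    (h : l.comp t e = l'.comp t' e') (hd : l.deg = l'.deg) : l = l' ∧ t = t' := by
  have hd' : t.deg = t'.deg := by
    have := congrArg Path.deg h
    rw [deg_comp, deg_comp, hd] at this
    exact add_left_cancel this
  obtain ⟨a, b, f⟩ := l
  obtain ⟨c, d, g⟩ := t
  obtain ⟨a', b', f'⟩ := l'
  obtain ⟨c', d', g'⟩ := t'
  obtain rfl : a = d := e
  obtain rfl : a' = d' := e'
  simp only [comp, eqToHom_refl, Category.id_comp, Path.mk.injEq] at h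
  obtain ⟨rfl, rfl, h⟩ := h
  have h := eq_of_heq h
  obtain ⟨q, -, hq⟩ := Λ.factorisation (g ≫ f) (Λ.degree f) (Λ.degree g)
    (by rw [Λ.degree_comp, add_comm])
  have h1 := hq ⟨a, f, g⟩ ⟨rfl, rfl, rfl⟩
  have h2 := hq ⟨a', f', g'⟩ ⟨h.symm, hd.symm, hd'.symm⟩
  have h3 := h1.trans h2.symm
  simp only [Sigma.mk.injEq] at h3
  obtain ⟨rfl, h3⟩ := h3
  have h3 := eq_of_heq h3
  simp only [Prod.mk.injEq] at h3
  obtain ⟨rfl, rfl⟩ := h3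
  exact ⟨rfl, rfl⟩

theorem comp_left_cancel {l t t' : Λ.Path} {e : l.src = t.rng} {e' : l.src = t'.rng}
    (h : l.comp t e = l.comp t' e') : t = t' :=
  (comp_inj h rfl).2

theorem comp_congr {l l' t t' : Λ.Path} (hl : l = l') (ht : t = t') (e : l.src = t.rng)
    (e' : l'.src = t'.rng) : l.comp t e = l'.comp t' e' := by
  subst hl ht
  rfl

theorem eq_vert_of_deg_eq_zero {l : Λ.Path} (h : l.deg = 0) : l = vert l.rng :=
  (comp_inj ((comp_vert l).trans (vert_comp l).symm) (h.trans (deg_vert _).symm)).1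

/-- The prefix order: `l ≤ p` if `p` extends `l`. -/
instance : PartialOrder Λ.Path where
  le l p := ∃ (t : Λ.Path) (e : l.src = t.rng), l.comp t e = p
  le_refl l := ⟨_, _, comp_vert l⟩
  le_trans := by
    rintro l _ _ ⟨t, e, rfl⟩ ⟨t', e', rfl⟩
    exact ⟨t.comp t' e', e, (comp_assoc l t t' e e').symm⟩
  le_antisymm := by
    rintro l _ ⟨t, e, rfl⟩ ⟨t', e', h⟩
    have hd : t.deg = 0 := by
      have := congrArg deg h
      rw [deg_comp, deg_comp] at this
      funext i
      have := congrFun this i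
      simp only [Pi.add_apply, Pi.zero_apply] at this ⊢
      omega
    have ht := eq_vert_of_deg_eq_zero hd
    refine (comp_vert l).symm.trans (comp_congr rfl ?_ _ _)
    rw [ht, e]

theorem le_comp (l t : Λ.Path) (e : l.src = t.rng) : l ≤ l.comp t e := ⟨t, e, rfl⟩

theorem deg_mono {l p : Λ.Path} (h : l ≤ p) : l.deg ≤ p.deg := by
  obtain ⟨t, e, rfl⟩ := h
  rw [deg_comp]
  exact le_self_add

theorem vert_rng_le (p : Λ.Path) : vert p.rng ≤ p := ⟨p, rfl, vert_comp p⟩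

theorem eq_of_le_of_deg_eq {l l' p : Λ.Path} (h : l ≤ p) (h' : l' ≤ p) (hd : l.deg = l'.deg) :
    l = l' := by
  obtain ⟨t, e, rfl⟩ := h
  obtain ⟨t', e', h'⟩ := h'
  exact (comp_inj h'.symm hd).1

theorem exists_le_deg_eq (p : Λ.Path) {n : Fin k → ℕ} (hn : n ≤ p.deg) : ∃ l ≤ p, l.deg = n := by
  obtain ⟨l, t, e, h, hd⟩ := p.exists_factor hn
  exact ⟨l, ⟨t, e, h⟩, hd⟩

/-- A path has one prefix of each degree below its own, so its prefixes are ordered as their degrees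
are. -/
theorem le_of_le_of_deg_le {l l' p : Λ.Path} (h : l ≤ p) (h' : l' ≤ p) (hd : l.deg ≤ l'.deg) :
    l ≤ l' := by
  obtain ⟨q, hq, hqd⟩ := l'.exists_le_deg_eq hd
  rwa [eq_of_le_of_deg_eq h (hq.trans h') hqd.symm]

theorem comp_le_comp_iff {l t t' : Λ.Path} {e : l.src = t.rng} {e' : l.src = t'.rng} :
    l.comp t e ≤ l.comp t' e' ↔ t ≤ t' := by
  constructor
  · rintro ⟨q, h, hq⟩
    exact ⟨q, h, comp_left_cancel (e := e) ((comp_assoc l t q e h).symm.trans hq)⟩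
  · rintro ⟨q, h, rfl⟩
    exact ⟨q, h, comp_assoc l t q e h⟩

end Path

open KGraph.Path

/-- Cut the common extension `p` at degree `d(l) ∨ d(m)`. Through this, `Λ^min` is used only via the
prefix order. -/
theorem exists_mem_minExt {l m p : Λ.Path} (hl : l ≤ p) (hm : m ≤ p) :
    ∃ q ∈ minExt l m, ∃ (h₁ : l.src = q.1.rng), l.comp q.1 h₁ ≤ p := by
  obtain ⟨c, hc, hd⟩ := p.exists_le_deg_eq (sup_le (deg_mono hl) (deg_mono hm))
  obtain ⟨s, e, rfl⟩ := le_of_le_of_deg_le hl hc (hd ▸ le_sup_left)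
  obtain ⟨t, e', h'⟩ := le_of_le_of_deg_le hm hc (hd ▸ le_sup_right)
  exact ⟨(s, t), ⟨e, e', h'.symm, hd⟩, e, hc⟩

theorem minExt_nonempty_iff {l m : Λ.Path} : (minExt l m).Nonempty ↔ ∃ p, l ≤ p ∧ m ≤ p := by
  constructor
  · rintro ⟨q, e, e', h, -⟩
    exact ⟨_, le_comp l _ e, _, e', h.symm⟩
  · rintro ⟨p, hl, hm⟩
    obtain ⟨q, hq, -⟩ := exists_mem_minExt hl hm
    exact ⟨q, hq⟩

theorem minExt_swap {l m : Λ.Path} {p : Λ.Path × Λ.Path} (h : p ∈ minExt l m) :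
    p.swap ∈ minExt m l := by
  obtain ⟨h₁, h₂, e, hd⟩ := h
  exact ⟨h₂, h₁, e.symm, (congrArg deg e.symm).trans (hd.trans (sup_comm _ _))⟩

/-- The tails of the minimal common extensions of a path with an exhaustive set. -/
theorem isExhaustive_minExt {a : Λ.Obj} {E : Set Λ.Path} (hE : IsExhaustive a E) {l : Λ.Path}
    (hl : l.rng = a) : IsExhaustive l.src {t | ∃ e ∈ E, ∃ s, (t, s) ∈ minExt l e} := by
  intro g hg
  obtain ⟨e, he, h⟩ := hE (l.comp g hg.symm) hl
  obtain ⟨p, h1, h2⟩ := minExt_nonempty_iff.1 h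
  obtain ⟨⟨t, s⟩, hq, h₁, hle⟩ := exists_mem_minExt ((le_comp _ _ _).trans h1) h2
  obtain ⟨r, hr, rfl⟩ := (le_comp _ _ _).trans hle
  refine ⟨t, ⟨e, he, s, hq⟩, minExt_nonempty_iff.2 ⟨r, comp_le_comp_iff.1 h1,
    comp_le_comp_iff.1 hle⟩⟩

/-! ### Infinite paths as filters of finite paths -/

namespace OmegaPath

/-- The finite initial segments of `x`. -/
def pre (x : Λ.OmegaPath) : Set Λ.Path :=
  {l | ∃ h : Below l.deg x.deg, x.seg 0 l.deg zero_le h = l}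

theorem below_zero (d : Fin k → ℕ∞) : Below 0 d := fun _ => by simp

theorem seg_mem_pre (x : Λ.OmegaPath) {n : Fin k → ℕ} (hn : Below n x.deg) :
    x.seg 0 n zero_le hn ∈ x.pre := by
  have hd : (x.seg 0 n zero_le hn).deg = n := by rw [x.deg_seg, tsub_zero]
  exact ⟨by rwa [hd], x.seg_congr _ _ rfl hd _ _⟩

theorem deg_seg_zero (x : Λ.OmegaPath) {n : Fin k → ℕ} (hn : Below n x.deg) :
    (x.seg 0 n zero_le hn).deg = n := by rw [x.deg_seg, tsub_zero]

theorem eq_seg_of_mem_pre {x : Λ.OmegaPath} {l : Λ.Path} (hl : l ∈ x.pre) {n : Fin k → ℕ}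
    (hn : Below n x.deg) (hd : l.deg = n) : x.seg 0 n zero_le hn = l := by
  subst hd
  exact hl.2

theorem eq_of_mem_pre {x : Λ.OmegaPath} {l l' : Λ.Path} (h : l ∈ x.pre) (h' : l' ∈ x.pre)
    (hd : l.deg = l'.deg) : l = l' :=
  (eq_seg_of_mem_pre h h'.1 hd).symm.trans (eq_seg_of_mem_pre h' h'.1 rfl)

theorem seg_le_seg (x : Λ.OmegaPath) {p q : Fin k → ℕ} (h : p ≤ q) (hq : Below q x.deg) :
    x.seg 0 p zero_le (hq.mono h) ≤ x.seg 0 q zero_le hq :=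
  ⟨_, _, x.seg_comp 0 p q zero_le h hq⟩

theorem mem_pre_of_le {x : Λ.OmegaPath} {l l' : Λ.Path} (h : l ≤ l') (h' : l' ∈ x.pre) :
    l ∈ x.pre := by
  have hb : Below l.deg x.deg := h'.1.mono (deg_mono h)
  refine ⟨hb, eq_of_le_of_deg_eq (p := l') ?_ h (x.deg_seg_zero hb)⟩
  have := x.seg_le_seg (deg_mono h) h'.1
  rwa [h'.2] at this

theorem exists_mem_pre_sup {x : Λ.OmegaPath} {l l' : Λ.Path} (h : l ∈ x.pre) (h' : l' ∈ x.pre) :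
    ∃ p ∈ x.pre, l ≤ p ∧ l' ≤ p ∧ p.deg = l.deg ⊔ l'.deg := by
  have hb := h.1.sup h'.1
  refine ⟨_, x.seg_mem_pre hb, ?_, ?_, x.deg_seg_zero hb⟩
  · have := x.seg_le_seg le_sup_left hb
    rwa [eq_seg_of_mem_pre h _ rfl] at this
  · have := x.seg_le_seg le_sup_right hb
    rwa [eq_seg_of_mem_pre h' _ rfl] at this

theorem below_iff (x : Λ.OmegaPath) (n : Fin k → ℕ) :
    Below n x.deg ↔ ∃ l ∈ x.pre, l.deg = n :=
  ⟨fun h => ⟨_, x.seg_mem_pre h, x.deg_seg_zero h⟩, fun ⟨_, h, e⟩ => e ▸ h.1⟩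

/-- The segment `x(p, q)` is the path `t` with `x(0, p) t = x(0, q)`. -/
theorem seg_eq_iff (x : Λ.OmegaPath) {l t : Λ.Path} (hl : l ∈ x.pre) {p q : Fin k → ℕ}
    (h : p ≤ q) (hq : Below q x.deg) (hp : l.deg = p) (hpq : l.deg + t.deg = q) :
    x.seg p q h hq = t ↔ ∃ e, l.comp t e ∈ x.pre := by
  subst hp
  have hc := x.seg_comp 0 l.deg q zero_le h hq
  have hl' := eq_seg_of_mem_pre hl (hq.mono h) rfl
  have hr : l.src = (x.seg l.deg q h hq).rng := by
    rw [x.rng_seg, ← x.src_seg 0 l.deg zero_le, hl']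
  have hc' : l.comp (x.seg l.deg q h hq) hr = x.seg 0 q zero_le hq := by
    rw [← hc]
    exact comp_congr hl'.symm rfl _ _
  constructor
  · rintro rfl
    exact ⟨hr, hc' ▸ x.seg_mem_pre hq⟩
  · rintro ⟨e, he⟩
    have := eq_seg_of_mem_pre he hq (by rw [deg_comp, hpq])
    exact comp_left_cancel (hc'.trans this)

theorem ext_pre {x y : Λ.OmegaPath} (h : x.pre = y.pre) : x = y := by
  have hb : ∀ n, Below n x.deg ↔ Below n y.deg := fun n => by rw [below_iff, below_iff, h]
  have hd : x.deg = y.deg := by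
    funext i
    -- Degrees with one nonzero coordinate detect each coordinate of the extended degree.
    have key : ∀ (d : Fin k → ℕ∞) (j : ℕ), Below (Pi.single i j) d ↔ (j : ℕ∞) ≤ d i := by
      intro d j
      constructor
      · intro h
        simpa using h i
      · intro h i'
        by_cases hi : i' = i
        · subst hi
          simpa using h
        · simp [hi]
    exact ENat.eq_of_forall_natCast_le_iff fun j => by rw [← key, ← key, hb]
  refine ext' hd fun p q hpq hx hy => ?_
  refine (x.seg_eq_iff (x.seg_mem_pre (hx.mono hpq)) hpq hx (x.deg_seg_zero _) ?_).2 ?_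
  · rw [x.deg_seg_zero, y.deg_seg, add_tsub_cancel_of_le hpq]
  · rw [h]
    have := (y.seg_eq_iff (t := y.seg p q hpq hy) (y.seg_mem_pre (hy.mono hpq)) hpq hy
      (y.deg_seg_zero _) (by rw [y.deg_seg_zero, y.deg_seg, add_tsub_cancel_of_le hpq])).1 rfl
    have e : x.seg 0 p zero_le (hx.mono hpq) = y.seg 0 p zero_le (hy.mono hpq) :=
      eq_of_mem_pre (x := y) (h ▸ x.seg_mem_pre _) (y.seg_mem_pre _)
        (by rw [x.deg_seg_zero, y.deg_seg_zero])
    rwa [e]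

theorem vert_mem_pre_iff {x : Λ.OmegaPath} {a : Λ.Obj} :
    vert a ∈ x.pre ↔ x.obj 0 (below_zero _) = a := by
  have key : x.seg 0 0 le_rfl (below_zero _) = vert (x.obj 0 (below_zero _)) := x.seg_self 0 _
  constructor
  · intro h
    have := eq_seg_of_mem_pre h (below_zero _) (deg_vert a)
    exact congrArg Path.rng (key.symm.trans this)
  · rintro rfl
    rw [← key]
    exact x.seg_mem_pre _

theorem vert_rng_mem_pre {x : Λ.OmegaPath} {l : Λ.Path} (h : l ∈ x.pre) : vert l.rng ∈ x.pre :=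
  mem_pre_of_le (vert_rng_le l) h

theorem rng_eq_of_mem_pre {x : Λ.OmegaPath} {l l' : Λ.Path} (h : l ∈ x.pre) (h' : l' ∈ x.pre) :
    l.rng = l'.rng :=
  (vert_mem_pre_iff.1 (vert_rng_mem_pre h)).symm.trans (vert_mem_pre_iff.1 (vert_rng_mem_pre h'))

theorem exists_vert_mem_pre (x : Λ.OmegaPath) : ∃ a, vert a ∈ x.pre := ⟨_, vert_mem_pre_iff.2 rfl⟩

/-- The vertex `x(n)` is the source of the prefix of degree `n`, so the boundary condition concerns
only the set of prefixes. -/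
theorem isBoundary_iff {x : Λ.OmegaPath} :
    x.IsBoundary ↔ ∀ l ∈ x.pre, ∀ E ∈ FE l.src, ∃ e ∈ E, ∃ h, l.comp e h ∈ x.pre := by
  have key : ∀ l ∈ x.pre, ∀ hl : Below l.deg x.deg, x.obj l.deg hl = l.src := by
    intro l hl hb
    rw [← x.src_seg 0 l.deg zero_le hb, hl.2]
  constructor
  · intro H l hl E hE
    rw [← key l hl hl.1] at hE
    obtain ⟨e, he, hb, h⟩ := H _ hl.1 E hE
    exact ⟨e, he, (x.seg_eq_iff hl _ hb rfl rfl).1 h⟩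
  · intro H n hn E hE
    obtain ⟨l, hl, rfl⟩ := (x.below_iff n).1 hn
    rw [key l hl] at hE
    obtain ⟨e, he, h, h'⟩ := H l hl E hE
    have hb : Below (l.deg + e.deg) x.deg := by
      rw [← deg_comp l e h]
      exact h'.1
    exact ⟨e, he, hb, (x.seg_eq_iff hl _ hb rfl rfl).2 ⟨h, h'⟩⟩

/-- Every nonempty, hereditary and directed set of paths is the set of the initial segments of an
infinite path. -/
theorem exists_pre_eq (S : Set Λ.Path) (hne : S.Nonempty) (hher : ∀ l p, l ≤ p → p ∈ S → l ∈ S)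
    (hdir : ∀ l ∈ S, ∀ m ∈ S, ∃ p ∈ S, l ≤ p ∧ m ≤ p) : ∃ x : Λ.OmegaPath, x.pre = S := by
  let d : Fin k → ℕ∞ := fun i => ⨆ l : S, (l.1.deg i : ℕ∞)
  have hbelow : ∀ l ∈ S, Below l.deg d := fun l hl i => le_iSup (fun l : S => (l.1.deg i : ℕ∞)) ⟨l, hl⟩
  have huniq : ∀ l ∈ S, ∀ m ∈ S, l.deg ≤ m.deg → l ≤ m := by
    intro l hl m hm h
    obtain ⟨p, -, h1, h2⟩ := hdir l hl m hm
    exact le_of_le_of_deg_le h1 h2 h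
  have hex : ∀ n, Below n d → ∃ l ∈ S, l.deg = n := by
    intro n hn
    have h1 : ∀ i, ∃ l ∈ S, n i ≤ l.deg i := by
      intro i
      by_contra! hc
      obtain ⟨l₀, hl₀⟩ := hne
      -- The subtraction does not truncate: `l₀` has `l₀.deg i < n i`, so `n i` is positive.
      have h2 : d i ≤ ((n i - 1 : ℕ) : ℕ∞) := iSup_le fun l => by
        have := hc l.1 l.2
        exact Nat.cast_le.2 (by omega)
      have h3 := Nat.cast_le.1 ((hn i).trans h2)
      have := hc l₀ hl₀
      omega
    have h2 : ∀ s : Finset (Fin k), ∃ l ∈ S, ∀ i ∈ s, n i ≤ l.deg i := by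
      intro s
      induction s using Finset.induction_on with
      | empty => exact ⟨hne.some, hne.some_mem, by simp⟩
      | insert i s _ ih =>
        obtain ⟨l, hl, h⟩ := ih
        obtain ⟨m, hm, h'⟩ := h1 i
        obtain ⟨p, hp, hlp, hmp⟩ := hdir l hl m hm
        refine ⟨p, hp, fun j hj => ?_⟩
        rcases Finset.mem_insert.1 hj with rfl | hj
        · exact h'.trans (deg_mono hmp j)
        · exact (h j hj).trans (deg_mono hlp j)
    obtain ⟨l, hl, h⟩ := h2 Finset.univ
    obtain ⟨p, hp, hpd⟩ := l.exists_le_deg_eq (n := n) fun i => h i (Finset.mem_univ i)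
    exact ⟨p, hher p l hp hl, hpd⟩
  -- `f n` is the element of `S` of degree `n`, the future `x(0, n)`; below, `g p q` is the tail
  -- with `f p · g p q = f q`, the future `x(p, q)`.
  choose f hfS hfd using hex
  have hseg : ∀ p q, p ≤ q → ∀ (hp : Below p d) (hq : Below q d),
      ∃ (t : Λ.Path) (e : (f p hp).src = t.rng), (f p hp).comp t e = f q hq := by
    intro p q h hp hq
    exact huniq _ (hfS p hp) _ (hfS q hq) (by rwa [hfd, hfd])
  choose g hg hgc using hseg
  let x : Λ.OmegaPath :=
    { deg := d
      obj := fun n hn => (f n hn).src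
      seg := fun p q h hq => g p q h (hq.mono h) hq
      rng_seg := fun p q h hq => (hg _ _ _ _ _).symm
      src_seg := fun p q h hq => by
        rw [← hgc p q h (hq.mono h) hq]
        rfl
      deg_seg := fun p q h hq => by
        have := congrArg Path.deg (hgc p q h (hq.mono h) hq)
        rw [deg_comp, hfd, hfd] at this
        exact eq_tsub_of_add_eq (by rw [add_comm, this])
      seg_self := fun p hp =>
        comp_left_cancel ((hgc p p le_rfl hp hp).trans (comp_vert _).symm)
      seg_comp := fun p q t h h' ht => by
        refine comp_left_cancel (l := f p (ht.mono (h.trans h')))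
          (e := hg p q h _ (ht.mono h')) (e' := hg _ _ _ _ _) ?_
        rw [hgc p t, ← hgc q t h' (ht.mono h') ht, ← comp_assoc]
        · exact comp_congr (hgc p q h _ _) rfl _ _ }
  have hzero : f 0 (below_zero _) = vert (f 0 (below_zero _)).rng := eq_vert_of_deg_eq_zero (hfd _ _)
  have hx : ∀ n (hn : Below n d), x.seg 0 n zero_le hn = f n hn := by
    intro n hn
    refine Eq.trans ?_ (hgc 0 n zero_le (below_zero _) hn)
    refine (vert_comp _).symm.trans (comp_congr ?_ rfl _ _)
    have h0 := hg 0 n zero_le (below_zero _) hn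
    change vert (g 0 n zero_le (below_zero _) hn).rng = _
    rw [← h0, hzero]
    rfl
  refine ⟨x, Set.ext fun l => ⟨?_, fun hl => ?_⟩⟩
  · rintro ⟨hb, h⟩
    rw [← h, hx]
    exact hfS _ _
  · refine ⟨hbelow l hl, (hx _ _).trans ?_⟩
    have h1 := hfd _ (hbelow l hl)
    exact le_antisymm (huniq _ (hfS _ _) _ hl h1.le) (huniq _ hl _ (hfS _ _) h1.ge)

end OmegaPath

/-- The degree `d(λ)`, as an element of `ℤ^k`. -/
def Path.zdeg (l : Λ.Path) : Fin k → ℤ := fun i => l.deg i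

theorem Path.zdeg_comp (l m : Λ.Path) (h : l.src = m.rng) :
    (l.comp m h).zdeg = l.zdeg + m.zdeg := by
  funext i
  simp [zdeg, deg_comp]

theorem Path.zdeg_vert (a : Λ.Obj) : (vert a).zdeg = 0 := by
  funext i
  simp [zdeg, deg_vert]

theorem Path.deg_eq_of_zdeg_eq {l m : Λ.Path} (h : l.zdeg = m.zdeg) : l.deg = m.deg :=
  funext fun i => Nat.cast_injective (congrFun h i)

/-! ### Prepending a finite path to an infinite path -/

namespace OmegaPath

/-- `Extends l w z` says that `z = l w`, that is, `z(0, d(l)) = l` and `σ^{d(l)} z = w`. -/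
def Extends (l : Λ.Path) (w z : Λ.OmegaPath) : Prop :=
  l ∈ z.pre ∧ ∀ t, t ∈ w.pre ↔ ∃ h, l.comp t h ∈ z.pre

theorem extends_shift {z : Λ.OmegaPath} {l : Λ.Path} (hl : l ∈ z.pre) :
    Extends l (z.shift l.deg hl.1) z := by
  refine ⟨hl, fun t => ⟨?_, ?_⟩⟩
  · rintro ⟨hb, h⟩
    exact (z.seg_eq_iff hl _ (hl.1.add_of_sub hb) (add_zero _).symm rfl).1 h
  · rintro ⟨e, h⟩
    have hb : Below (l.deg + t.deg) z.deg := by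
      rw [← deg_comp l t e]
      exact h.1
    exact ⟨hb.sub_of_add, (z.seg_eq_iff hl _ hb (add_zero _).symm rfl).2 ⟨e, h⟩⟩

theorem Extends.vert_mem {l : Λ.Path} {w z : Λ.OmegaPath} (h : Extends l w z) :
    vert l.src ∈ w.pre := (h.2 _).2 ⟨rfl, by rw [comp_vert]; exact h.1⟩

theorem Extends.rng_eq {l t : Λ.Path} {w z : Λ.OmegaPath} (h : Extends l w z) (ht : t ∈ w.pre) :
    l.src = t.rng := rng_eq_of_mem_pre h.vert_mem ht

theorem Extends.comp_mem {l t : Λ.Path} {w z : Λ.OmegaPath} (h : Extends l w z)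
    (ht : t ∈ w.pre) : l.comp t (h.rng_eq ht) ∈ z.pre := ((h.2 t).1 ht).2

theorem Extends.mem_of_comp_mem {l t : Λ.Path} {w z : Λ.OmegaPath} (h : Extends l w z)
    {e : l.src = t.rng} (ht : l.comp t e ∈ z.pre) : t ∈ w.pre := (h.2 t).2 ⟨e, ht⟩

theorem Extends.tail_unique {l : Λ.Path} {w w' z : Λ.OmegaPath} (h : Extends l w z)
    (h' : Extends l w' z) : w = w' :=
  ext_pre (Set.ext fun t => (h.2 t).trans (h'.2 t).symm)

/-- A prefix of `z = l w` and `l` have a common extension among the prefixes of `z`, which has the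
form `l t`. Hence `l` and `w` determine `z`. -/
theorem Extends.mem_pre_iff {l : Λ.Path} {w z : Λ.OmegaPath} (h : Extends l w z) (p : Λ.Path) :
    p ∈ z.pre ↔ ∃ t ∈ w.pre, ∃ e : l.src = t.rng, p ≤ l.comp t e := by
  constructor
  · intro hp
    obtain ⟨_, hq, ⟨t, e, rfl⟩, h2, -⟩ := exists_mem_pre_sup h.1 hp
    exact ⟨t, h.mem_of_comp_mem hq, e, h2⟩
  · rintro ⟨t, ht, e, hp⟩
    exact mem_pre_of_le hp (h.comp_mem ht)

theorem Extends.unique {l : Λ.Path} {w z z' : Λ.OmegaPath} (h : Extends l w z)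
    (h' : Extends l w z') : z = z' :=
  ext_pre (Set.ext fun t => (h.mem_pre_iff t).trans (h'.mem_pre_iff t).symm)

theorem exists_extends {l : Λ.Path} {w : Λ.OmegaPath} (h : vert l.src ∈ w.pre) :
    ∃ z, Extends l w z := by
  obtain ⟨z, hz⟩ := exists_pre_eq {p | ∃ t ∈ w.pre, ∃ e : l.src = t.rng, p ≤ l.comp t e}
    ⟨l, vert l.src, h, rfl, by rw [comp_vert]⟩
    (fun p q hpq ⟨t, ht, e, hq⟩ => ⟨t, ht, e, hpq.trans hq⟩) (by
      rintro p ⟨t, ht, e, hp⟩ q ⟨t', ht', e', hq⟩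
      obtain ⟨s, hs, h1, h2, -⟩ := exists_mem_pre_sup ht ht'
      have es : l.src = s.rng := e.trans (rng_eq_of_mem_pre ht hs)
      exact ⟨l.comp s es, ⟨s, hs, es, le_rfl⟩, hp.trans (comp_le_comp_iff.2 h1),
        hq.trans (comp_le_comp_iff.2 h2)⟩)
  refine ⟨z, ?_, fun t => ?_⟩
  · rw [hz]
    exact ⟨vert l.src, h, rfl, by rw [comp_vert]⟩
  · rw [hz]
    constructor
    · intro ht
      have e : l.src = t.rng := rng_eq_of_mem_pre h ht
      exact ⟨e, t, ht, e, le_rfl⟩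
    · rintro ⟨e, s, hs, e', hle⟩
      exact mem_pre_of_le (comp_le_comp_iff.1 hle) hs

theorem Extends.comp {l m : Λ.Path} {w y z : Λ.OmegaPath} (h : Extends l y z)
    (h' : Extends m w y) : Extends (l.comp m (h.rng_eq h'.1)) w z := by
  refine ⟨h.comp_mem h'.1, fun t => ⟨fun ht => ⟨h'.rng_eq ht, ?_⟩, ?_⟩⟩
  · rw [comp_assoc l m t _ (h'.rng_eq ht)]
    exact h.comp_mem (h'.comp_mem ht)
  · rintro ⟨e, ht⟩
    rw [comp_assoc l m t _ e] at ht
    exact h'.mem_of_comp_mem (h.mem_of_comp_mem ht)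

theorem Extends.exists_of_comp {l m : Λ.Path} {e : l.src = m.rng} {w z : Λ.OmegaPath}
    (h : Extends (l.comp m e) w z) : ∃ y, Extends l y z ∧ Extends m w y := by
  have hy := extends_shift (mem_pre_of_le (le_comp l m e) h.1)
  have hw := extends_shift (hy.mem_of_comp_mem h.1)
  rw [(hy.comp hw).tail_unique h] at hw
  exact ⟨_, hy, hw⟩

theorem extends_vert_iff {a : Λ.Obj} {w z : Λ.OmegaPath} :
    Extends (vert a) w z ↔ w = z ∧ vert a ∈ z.pre := by
  have key : ∀ z : Λ.OmegaPath, vert a ∈ z.pre → Extends (vert a) z z := by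
    refine fun z hz => ⟨hz, fun t => ⟨fun ht => ?_, ?_⟩⟩
    · obtain rfl : a = t.rng := rng_eq_of_mem_pre hz ht
      exact ⟨rfl, by rwa [vert_comp]⟩
    · rintro ⟨e, ht⟩
      obtain rfl : a = t.rng := e
      rwa [vert_comp] at ht
  constructor
  · exact fun h => ⟨h.tail_unique (key z h.1), h.1⟩
  · rintro ⟨rfl, h⟩
    exact key w h

theorem Extends.isBoundary_tail {l : Λ.Path} {w z : Λ.OmegaPath} (h : Extends l w z)
    (hz : z.IsBoundary) : w.IsBoundary := by
  rw [isBoundary_iff] at hz ⊢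
  intro t ht E hE
  obtain ⟨e, he, h', hm⟩ := hz _ (h.comp_mem ht) E hE
  have h'' : t.src = e.rng := h'
  rw [comp_assoc l t e _ h''] at hm
  exact ⟨e, he, h'', h.mem_of_comp_mem hm⟩

/-- A prefix `p` of `z` need not reach past `l`. Lengthen it to `p q = l t` with `t` a prefix of
`w`, and replace `E` by the tails of its minimal common extensions with `q`. They form an exhaustive
set at `s(t)`, finite by finite alignment, to which the boundary condition of `w` applies. -/
theorem Extends.isBoundary [Λ.FinitelyAligned] {l : Λ.Path} {w z : Λ.OmegaPath}
    (h : Extends l w z) (hw : w.IsBoundary) : z.IsBoundary := by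
  rw [isBoundary_iff] at hw ⊢
  intro p hp E hE
  obtain ⟨t, ht, e, q, hq, hpq⟩ := (h.mem_pre_iff p).1 hp
  have hlt := h.comp_mem ht
  suffices H : ∃ e ∈ E, ∃ s r, ∃ (h₁ : q.src = s.rng) (h₂ : e.src = r.rng),
      q.comp s h₁ = e.comp r h₂ ∧ p.comp (q.comp s h₁) hq ∈ z.pre by
    obtain ⟨e, he, s, r, h₁, h₂, hqe, hz⟩ := H
    have hr : p.src = e.rng := hq.trans (congrArg (fun p => Path.rng p) hqe :)
    refine ⟨e, he, hr, mem_pre_of_le (comp_le_comp_iff.2 ?_) hz⟩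
    exact ⟨r, h₂, hqe.symm⟩
  have hqs : q.src = t.src := (congrArg (fun p => Path.src p) hpq :)
  let E' : Set Λ.Path := {t | ∃ e ∈ (E : Set Λ.Path), ∃ s, (t, s) ∈ minExt q e}
  have hfin : E'.Finite := by
    refine (Set.Finite.biUnion E.finite_toSet fun e _ =>
      (FinitelyAligned.finite_minExt q e).image Prod.fst).subset ?_
    rintro t ⟨e, he, s, hs⟩
    exact Set.mem_biUnion he ⟨(t, s), hs, rfl⟩
  have hex : IsExhaustive q.src E' := isExhaustive_minExt hE.2 hq.symm
  have hbase : ∃ s ∈ E', ∃ h₁ : t.src = s.rng, t.comp s h₁ ∈ w.pre := by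
    -- A set containing the vertex is not in `FE`, but then `t` needs no further extension.
    by_cases hv : vert q.src ∈ E'
    · exact ⟨_, hv, hqs.symm, by
        have := comp_congr (rfl : t = t) (congrArg vert hqs) hqs.symm rfl
        rwa [this, comp_vert]⟩
    · have hFE : hfin.toFinset ∈ FE t.src := by
        rw [← hqs]
        refine ⟨fun s hs => ?_, by rwa [hfin.coe_toFinset]⟩
        rw [hfin.mem_toFinset] at hs
        refine ⟨?_, fun hs' => hv (hs' ▸ hs)⟩
        obtain ⟨e, -, r, h₁, -⟩ := hs
        exact h₁.symm
      obtain ⟨s, hs, h₁, hw'⟩ := hw t ht _ hFE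
      exact ⟨s, hfin.mem_toFinset.1 hs, h₁, hw'⟩
  obtain ⟨s, ⟨e', he', r, h₁, h₂, hqe, -⟩, hs, hw'⟩ := hbase
  refine ⟨e', he', s, r, h₁, h₂, hqe, ?_⟩
  rw [← comp_assoc p q s hq h₁]
  have := h.comp_mem hw'
  rw [← comp_assoc l t s e hs] at this
  have hc : (p.comp q hq).comp s h₁ = (l.comp t e).comp s hs := comp_congr hpq rfl _ _
  exact hc.symm ▸ this

end OmegaPath

open OmegaPath

/-! ### Adding and removing initial segments of boundary paths -/

namespace BoundaryPath

theorem exists_extends_tail {l : Λ.Path} {z : Λ.BoundaryPath} (h : l ∈ z.1.pre) :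
    ∃ w : Λ.BoundaryPath, Extends l w.1 z.1 :=
  ⟨⟨_, (extends_shift h).isBoundary_tail z.2⟩, extends_shift h⟩

theorem exists_extends [Λ.FinitelyAligned] {l : Λ.Path} {w : Λ.BoundaryPath}
    (h : vert l.src ∈ w.1.pre) : ∃ z : Λ.BoundaryPath, Extends l w.1 z.1 := by
  obtain ⟨z, hz⟩ := OmegaPath.exists_extends h
  exact ⟨⟨z, hz.isBoundary w.2⟩, hz⟩

/-- The boundary condition without the requirement that `E` avoid the vertex, for which `l` itself
is the answer. -/
theorem exists_mem_pre_of_isExhaustive {x : Λ.BoundaryPath} {l : Λ.Path} (hl : l ∈ x.1.pre)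
    {E : Set Λ.Path} (hfin : E.Finite) (hE : ∀ e ∈ E, e.rng = l.src) (hex : IsExhaustive l.src E) :
    ∃ e ∈ E, ∃ h, l.comp e h ∈ x.1.pre := by
  by_cases hv : vert l.src ∈ E
  · exact ⟨_, hv, rfl, by rwa [comp_vert]⟩
  · obtain ⟨e, he, h⟩ := isBoundary_iff.1 x.2 l hl hfin.toFinset
      ⟨fun e he => ⟨hE e (hfin.mem_toFinset.1 he), fun h => hv (h ▸ hfin.mem_toFinset.1 he)⟩,
        by rwa [hfin.coe_toFinset]⟩
    exact ⟨e, hfin.mem_toFinset.1 he, h⟩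

open Classical in
/-- The boundary path `w` with `z = l w`, if `z` starts with `l`. -/
def drop (l : Λ.Path) (z : Λ.BoundaryPath) : Λ.BoundaryPath :=
  if h : l ∈ z.1.pre then (exists_extends_tail h).choose else z

open Classical in
/-- The boundary path `l w`, if the range of `w` is the source of `l`. -/
def append [Λ.FinitelyAligned] (l : Λ.Path) (w : Λ.BoundaryPath) : Λ.BoundaryPath :=
  if h : vert l.src ∈ w.1.pre then (exists_extends h).choose else w

theorem extends_drop {l : Λ.Path} {z : Λ.BoundaryPath} (h : l ∈ z.1.pre) :
    Extends l (drop l z).1 z.1 := by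
  rw [drop, dif_pos h]
  exact (exists_extends_tail h).choose_spec

theorem extends_append [Λ.FinitelyAligned] {l : Λ.Path} {w : Λ.BoundaryPath}
    (h : vert l.src ∈ w.1.pre) : Extends l w.1 (append l w).1 := by
  rw [append, dif_pos h]
  exact (exists_extends h).choose_spec

theorem drop_eq {l : Λ.Path} {w z : Λ.BoundaryPath} (h : Extends l w.1 z.1) : drop l z = w :=
  Subtype.ext ((extends_drop h.1).tail_unique h)

theorem append_eq [Λ.FinitelyAligned] {l : Λ.Path} {w z : Λ.BoundaryPath}
    (h : Extends l w.1 z.1) : append l w = z :=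
  Subtype.ext ((extends_append h.vert_mem).unique h)

end BoundaryPath

open BoundaryPath

/-! ### The sets `Z(λ *_s μ)` -/

theorem mem_Z_iff {l m : Λ.Path} {a : GroupoidArrow Λ.BoundaryPath} :
    a ∈ Z l m ↔ ∃ w : Λ.BoundaryPath, Extends l w.1 a.rng.1 ∧ Extends m w.1 a.src.1 ∧
      a.hom.1 = l.zdeg - m.zdeg := by
  constructor
  · rintro ⟨hl, hm, h1, h2, h3, h4⟩
    have e1 := extends_shift (z := a.rng.1) (l := l) ⟨hl, h1⟩
    have e2 := extends_shift (z := a.src.1) (l := m) ⟨hm, h2⟩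
    rw [← h4] at e2
    exact ⟨⟨_, e1.isBoundary_tail a.rng.2⟩, e1, e2, funext h3⟩
  · rintro ⟨w, h1, h2, h3⟩
    exact ⟨h1.1.1, h2.1.1, h1.1.2, h2.1.2, congrFun h3,
      ((extends_shift h1.1).tail_unique h1).trans ((extends_shift h2.1).tail_unique h2).symm⟩

theorem shiftRel_of_extends {l m : Λ.Path} {w x y : Λ.BoundaryPath} (h : Extends l w.1 x.1)
    (h' : Extends m w.1 y.1) : ShiftRel x (l.zdeg - m.zdeg) y :=
  ⟨l.deg, m.deg, h.1.1, h'.1.1, fun _ => rfl,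
    ((extends_shift h.1).tail_unique h).trans ((extends_shift h'.1).tail_unique h').symm⟩

/-- The arrow `(l w, d(l) - d(m), m w)`. -/
def extArrow {l m : Λ.Path} {w x y : Λ.BoundaryPath} (h : Extends l w.1 x.1)
    (h' : Extends m w.1 y.1) : GroupoidArrow Λ.BoundaryPath :=
  ⟨y, x, ⟨l.zdeg - m.zdeg, shiftRel_of_extends h h'⟩⟩

theorem exists_mem_Z (a : GroupoidArrow Λ.BoundaryPath) :
    ∃ l m : Λ.Path, l.src = m.src ∧ a ∈ Z l m := by
  obtain ⟨y, x, m, p, q, hp, hq, hm, e⟩ := a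
  obtain ⟨l, hl, rfl⟩ := (x.1.below_iff p).1 hp
  obtain ⟨l', hl', rfl⟩ := (y.1.below_iff q).1 hq
  have h1 := extends_shift hl
  have h2 := extends_shift hl'
  rw [← e] at h2
  exact ⟨l, l', rng_eq_of_mem_pre h1.vert_mem h2.vert_mem, mem_Z_iff.2
    ⟨⟨_, h1.isBoundary_tail x.2⟩, h1, h2, funext hm⟩⟩

theorem src_eq_of_mem_Z {l m : Λ.Path} {a : GroupoidArrow Λ.BoundaryPath} (h : a ∈ Z l m) :
    l.src = m.src := by
  obtain ⟨w, h1, h2, -⟩ := mem_Z_iff.1 h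
  exact rng_eq_of_mem_pre h1.vert_mem h2.vert_mem

theorem mem_Z_comp_iff {l m n : Λ.Path} {a : GroupoidArrow Λ.BoundaryPath}
    {w : Λ.OmegaPath} (h : a ∈ Z l m) (hw : Extends l w a.rng.1) (e : l.src = n.rng)
    (e' : m.src = n.rng) : a ∈ Z (l.comp n e) (m.comp n e') ↔ n ∈ w.pre := by
  obtain ⟨w, h1, h2, h3⟩ := mem_Z_iff.1 h
  obtain rfl := h1.tail_unique hw
  rw [mem_Z_iff]
  constructor
  · rintro ⟨t, h4, -⟩
    exact h1.mem_of_comp_mem h4.1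
  · intro hn
    obtain ⟨t, ht⟩ := exists_extends_tail hn
    exact ⟨t, h1.comp ht, h2.comp ht, by rw [h3, zdeg_comp, zdeg_comp]; abel⟩

theorem mem_Z_of_mem_Z_comp {l m n : Λ.Path} {a : GroupoidArrow Λ.BoundaryPath}
    {e : l.src = n.rng} {e' : m.src = n.rng} (h : a ∈ Z (l.comp n e) (m.comp n e')) :
    a ∈ Z l m := by
  obtain ⟨w, h1, h2, h3⟩ := mem_Z_iff.1 h
  obtain ⟨y, h4, h5⟩ := h1.exists_of_comp
  obtain ⟨y', h6, h7⟩ := h2.exists_of_comp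
  obtain rfl := h5.unique h7
  exact mem_Z_iff.2 ⟨⟨y, h4.isBoundary_tail a.rng.2⟩, h4, h6,
    by rw [h3, zdeg_comp, zdeg_comp]; abel⟩

/-- If an arrow of `Z(λν *_s ω)` belongs to `Z(λ *_s μ)`, then `ω = μν`. -/
theorem eq_comp_of_mem_Z {l m n o : Λ.Path} {a : GroupoidArrow Λ.BoundaryPath}
    {e : l.src = n.rng} (e' : m.src = n.rng) (h : a ∈ Z l m) (h' : a ∈ Z (l.comp n e) o) :
    o = m.comp n e' := by
  obtain ⟨w, h1, h2, h3⟩ := mem_Z_iff.1 h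
  obtain ⟨w', h4, h5, h6⟩ := mem_Z_iff.1 h'
  have hn := h1.mem_of_comp_mem h4.1
  refine eq_of_mem_pre h5.1 (h2.comp_mem hn) (deg_eq_of_zdeg_eq ?_)
  rw [zdeg_comp] at h6 ⊢
  rw [h3] at h6
  have : o.zdeg = l.zdeg + n.zdeg - (l.zdeg - m.zdeg) := by rw [h6]; abel
  rw [this]
  abel

/-- The range of `a` has both `l` and `l'` as prefixes, hence also a minimal common extension `lρ =
l'τ`. The degree of `a` fixes the degree of the corresponding prefix of its source, which forces `mρ
= m'τ`. -/
theorem mem_Z_inter_iff {l m l' m' : Λ.Path} (h : l.src = m.src) (h' : l'.src = m'.src)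
    (a : GroupoidArrow Λ.BoundaryPath) :
    a ∈ Z l m ∧ a ∈ Z l' m' ↔ ∃ p ∈ minExt l l', ∃ (h₁ : l.src = p.1.rng) (h₂ : m.src = p.1.rng)
      (h₃ : m'.src = p.2.rng), m.comp p.1 h₂ = m'.comp p.2 h₃ ∧
        a ∈ Z (l.comp p.1 h₁) (m.comp p.1 h₂) := by
  constructor
  · rintro ⟨ha, ha'⟩
    obtain ⟨w, h1, h2, h3⟩ := mem_Z_iff.1 ha
    obtain ⟨c, hc, hl, hl', -⟩ := exists_mem_pre_sup h1.1 (mem_Z_iff.1 ha').choose_spec.1.1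
    obtain ⟨p, hp, e, hle⟩ := exists_mem_minExt hl hl'
    have hlp := mem_pre_of_le hle hc
    have hZ := (mem_Z_comp_iff ha h1 e (h.symm.trans e)).2 (h1.mem_of_comp_mem hlp)
    obtain ⟨h₁, h₂, hpe, -⟩ := id hp
    have hZ' := hZ
    rw [hpe] at hZ'
    exact ⟨p, hp, h₁, h.symm.trans h₁, h'.symm.trans h₂, eq_comp_of_mem_Z _ ha' hZ', hZ⟩
  · rintro ⟨p, ⟨_, h₅, hpe, -⟩, h₁, h₂, h₃, hm, ha⟩
    refine ⟨mem_Z_of_mem_Z_comp ha, ?_⟩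
    rw [hpe, hm] at ha
    exact mem_Z_of_mem_Z_comp (e := h₅) ha

/-! ### The relations of a Kumjian-Pask family -/

theorem minExt_self (l : Λ.Path) : minExt l l = {(vert l.src, vert l.src)} := by
  ext ⟨p, q⟩
  constructor
  · rintro ⟨h₁, h₂, e, hd⟩
    have hpq := comp_left_cancel e
    have hp : p.deg = 0 := by
      rw [deg_comp, sup_idem] at hd
      simpa using hd
    have hv : p = vert l.src := by
      rw [eq_vert_of_deg_eq_zero hp]
      exact congrArg vert h₁.symm
    simp only at hpq
    rw [← hpq, hv]
    rfl
  · rintro ⟨⟩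
    exact ⟨rfl, rfl, rfl, by rw [comp_vert, sup_idem]⟩

namespace IsKPFamily

variable [Λ.FinitelyAligned] {A : Type*} [NonUnitalRing A] {S T : Λ.Path → A}

theorem path_mul_vert (h : IsKPFamily S T) (l : Λ.Path) : S l * S (vert l.src) = S l := by
  rw [h.mul l (vert l.src) rfl, comp_vert]

theorem vert_mul_path (h : IsKPFamily S T) (l : Λ.Path) : S (vert l.rng) * S l = S l := by
  rw [h.mul (vert l.rng) l rfl, vert_comp]

theorem vert_mul_ghost (h : IsKPFamily S T) (l : Λ.Path) : S (vert l.src) * T l = T l := by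
  rw [← h.ghost_vert, h.ghost_mul l (vert l.src) rfl, comp_vert]

theorem ghost_mul_vert (h : IsKPFamily S T) (l : Λ.Path) : T l * S (vert l.rng) = T l := by
  rw [← h.ghost_vert, h.ghost_mul (vert l.rng) l rfl, vert_comp]

theorem path_mul_eq_zero (h : IsKPFamily S T) {l m : Λ.Path} (hlm : l.src ≠ m.rng) :
    S l * S m = 0 := by
  rw [← h.path_mul_vert l, ← h.vert_mul_path m, mul_assoc, ← mul_assoc (S (vert l.src)),
    h.orth _ _ hlm, zero_mul, mul_zero]

theorem ghost_mul_eq_zero (h : IsKPFamily S T) {l m : Λ.Path} (hlm : l.src ≠ m.rng) :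
    T m * T l = 0 := by
  rw [← h.ghost_mul_vert m, ← h.vert_mul_ghost l, mul_assoc, ← mul_assoc (S (vert m.rng)),
    h.orth _ _ hlm.symm, zero_mul, mul_zero]

theorem path_mul_ghost_eq_zero (h : IsKPFamily S T) {l m : Λ.Path} (hlm : l.src ≠ m.src) :
    S l * T m = 0 := by
  rw [← h.path_mul_vert l, ← h.vert_mul_ghost m, mul_assoc, ← mul_assoc (S (vert l.src)),
    h.orth _ _ hlm, zero_mul, mul_zero]

theorem ghost_mul_self (h : IsKPFamily S T) (l : Λ.Path) : T l * S l = S (vert l.src) := by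
  rw [h.ghost_mul_path, Finset.sum_eq_single (vert l.src, vert l.src), h.ghost_vert, h.idem]
  · intro b hb hne
    rw [Set.Finite.mem_toFinset, minExt_self] at hb
    exact (hne hb).elim
  · intro hb
    rw [Set.Finite.mem_toFinset, minExt_self] at hb
    exact (hb rfl).elim

end IsKPFamily

/-! ### A spanning set of the Kumjian-Pask algebra -/

namespace KumjianPask

variable (R : Type w) [CommRing R] [Λ.FinitelyAligned]

variable (Λ) in
/-- The elements `s_λ s_{μ*}` span the Kumjian-Pask algebra. -/
theorem span_path_mul_ghost :
    Submodule.span R (Set.range fun p : {p : Λ.Path × Λ.Path // p.1.src = p.2.src} =>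
      path R p.1.1 * ghost R p.1.2) = ⊤ := by
  have hF := isKPFamily (Λ := Λ) R
  set M := Submodule.span R (Set.range fun p : {p : Λ.Path × Λ.Path // p.1.src = p.2.src} =>
      path R p.1.1 * ghost R p.1.2) with hM
  have hgen : ∀ l m : Λ.Path, path R l * ghost R m ∈ M := by
    intro l m
    by_cases h : l.src = m.src
    · exact Submodule.subset_span ⟨⟨(l, m), h⟩, rfl⟩
    · rw [hF.path_mul_ghost_eq_zero h]
      exact M.zero_mem
  -- By (KP2) and (KP3) the span is stable under left multiplication by each letter, so it contains
  -- all words by induction on their length.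
  have hpath : ∀ l : Λ.Path, ∀ a ∈ M, path R l * a ∈ M := by
    intro l a ha
    induction ha using Submodule.span_induction with
    | mem a ha =>
      obtain ⟨⟨⟨m, n⟩, -⟩, rfl⟩ := ha
      change path R l * (path R m * ghost R n) ∈ M
      rw [← mul_assoc]
      by_cases h : l.src = m.rng
      · rw [hF.mul l m h]
        exact hgen _ _
      · rw [hF.path_mul_eq_zero h, zero_mul]
        exact M.zero_mem
    | zero => rw [mul_zero]; exact M.zero_mem
    | add a b _ _ h1 h2 => rw [mul_add]; exact M.add_mem h1 h2
    | smul r a _ h => rw [mul_smul_comm]; exact M.smul_mem r h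
  have hghost : ∀ l : Λ.Path, ∀ a ∈ M, ghost R l * a ∈ M := by
    intro l a ha
    induction ha using Submodule.span_induction with
    | mem a ha =>
      obtain ⟨⟨⟨m, n⟩, -⟩, rfl⟩ := ha
      change ghost R l * (path R m * ghost R n) ∈ M
      rw [← mul_assoc, hF.ghost_mul_path, Finset.sum_mul]
      refine M.sum_mem fun p _ => ?_
      rw [mul_assoc]
      by_cases h : n.src = p.2.rng
      · rw [hF.ghost_mul n p.2 h]
        exact hgen _ _
      · rw [hF.ghost_mul_eq_zero h, mul_zero]
        exact M.zero_mem
    | zero => rw [mul_zero]; exact M.zero_mem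
    | add a b _ _ h1 h2 => rw [mul_add]; exact M.add_mem h1 h2
    | smul r a _ h => rw [mul_smul_comm]; exact M.smul_mem r h
  have hpath' : ∀ l : Λ.Path, path R l ∈ M := fun l => by
    have := hgen l (vert l.src)
    rwa [hF.ghost_vert, hF.path_mul_vert] at this
  have hghost' : ∀ l : Λ.Path, ghost R l ∈ M := fun l => by
    have := hgen (vert l.src) l
    rwa [hF.vert_mul_ghost] at this
  have hword : ∀ x : FreeSemigroup Λ.Letter, mk R (MonoidAlgebra.single x 1) ∈ M := by
    intro x
    induction x using FreeSemigroup.recOnMul with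
    | ih1 x =>
      cases x with
      | path l => exact hpath' l
      | ghost l => exact hghost' l
    | ih2 x y _ hy =>
      have : mk (Λ := Λ) R (MonoidAlgebra.single (FreeSemigroup.of x * y) 1) =
          mk R (MonoidAlgebra.single (FreeSemigroup.of x) 1) * mk R (MonoidAlgebra.single y 1) := by
        rw [← map_mul, MonoidAlgebra.single_mul_single, one_mul]
      rw [this]
      cases x with
      | path l => exact hpath l _ hy
      | ghost l => exact hghost l _ hy
  rw [eq_top_iff]
  rintro a -
  obtain ⟨a, rfl⟩ := mk_surjective R a
  induction a using MonoidAlgebra.induction_linear with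
  | zero => rw [map_zero]; exact M.zero_mem
  | add a b ha hb => rw [map_add]; exact M.add_mem ha hb
  | single x r =>
    have : MonoidAlgebra.single x r = r • (MonoidAlgebra.single x 1 : FreeAlg Λ R) := by
      rw [MonoidAlgebra.smul_single, smul_eq_mul, mul_one]
    rw [this, mk_smul]
    exact M.smul_mem r (hword x)

end KumjianPask

open KGraph.Path KGraph.OmegaPath KGraph.BoundaryPath

/-! ### The representation on the functions on `∂Λ × ℤ^k` -/

section Rep

variable (R : Type w) [CommRing R]

open Classical in
/-- The operator `(S_λ ξ)(λ w, m) = ξ(w, m - d(λ))`. -/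
def pathOp (l : Λ.Path) : Module.End R (Λ.BoundaryPath × (Fin k → ℤ) → R) where
  toFun ξ p := if l ∈ p.1.1.pre then ξ (drop l p.1, p.2 - l.zdeg) else 0
  map_add' ξ η := by
    funext p
    by_cases h : l ∈ p.1.1.pre <;> simp [h]
  map_smul' r ξ := by
    funext p
    by_cases h : l ∈ p.1.1.pre <;> simp [h]

variable {R}

theorem pathOp_of_extends {l : Λ.Path} {w z : Λ.BoundaryPath} (h : Extends l w.1 z.1)
    (ξ : Λ.BoundaryPath × (Fin k → ℤ) → R) (m : Fin k → ℤ) :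
    pathOp R l ξ (z, m) = ξ (w, m - l.zdeg) := by
  simp [pathOp, h.1, drop_eq h]

theorem pathOp_of_notMem {l : Λ.Path} {z : Λ.BoundaryPath} (h : l ∉ z.1.pre)
    (ξ : Λ.BoundaryPath × (Fin k → ℤ) → R) (m : Fin k → ℤ) : pathOp R l ξ (z, m) = 0 := by
  simp [pathOp, h]

theorem pathOp_vert {a : Λ.Obj} {x : Λ.BoundaryPath} (h : vert a ∈ x.1.pre)
    (ξ : Λ.BoundaryPath × (Fin k → ℤ) → R) (m : Fin k → ℤ) :
    pathOp R (vert a) ξ (x, m) = ξ (x, m) := by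
  rw [pathOp_of_extends (extends_vert_iff.2 ⟨rfl, h⟩), zdeg_vert, sub_zero]

variable (R) [Λ.FinitelyAligned]

open Classical in
/-- The operator `(S_{λ*} ξ)(w, m) = ξ(λ w, m + d(λ))`. -/
def ghostOp (l : Λ.Path) : Module.End R (Λ.BoundaryPath × (Fin k → ℤ) → R) where
  toFun ξ p := if vert l.src ∈ p.1.1.pre then ξ (append l p.1, p.2 + l.zdeg) else 0
  map_add' ξ η := by
    funext p
    by_cases h : vert l.src ∈ p.1.1.pre <;> simp [h]
  map_smul' r ξ := by
    funext p
    by_cases h : vert l.src ∈ p.1.1.pre <;> simp [h]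

variable {R}

theorem ghostOp_of_extends {l : Λ.Path} {w z : Λ.BoundaryPath} (h : Extends l w.1 z.1)
    (ξ : Λ.BoundaryPath × (Fin k → ℤ) → R) (m : Fin k → ℤ) :
    ghostOp R l ξ (w, m) = ξ (z, m + l.zdeg) := by
  simp [ghostOp, h.vert_mem, append_eq h]

theorem ghostOp_of_notMem {l : Λ.Path} {w : Λ.BoundaryPath} (h : vert l.src ∉ w.1.pre)
    (ξ : Λ.BoundaryPath × (Fin k → ℤ) → R) (m : Fin k → ℤ) : ghostOp R l ξ (w, m) = 0 := by
  simp [ghostOp, h]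

theorem path_ghostOp_of_mem {l : Λ.Path} {x : Λ.BoundaryPath} (h : l ∈ x.1.pre)
    (ξ : Λ.BoundaryPath × (Fin k → ℤ) → R) (m : Fin k → ℤ) :
    pathOp R l (ghostOp R l ξ) (x, m) = ξ (x, m) := by
  obtain ⟨w, hw⟩ := exists_extends_tail h
  rw [pathOp_of_extends hw, ghostOp_of_extends hw, sub_add_cancel]

/-- At `x`, the operator of `s_l s_{l*}` multiplies by 1 or 0 according as `l` is a prefix of `x`.
One prefix of `x` in `L` therefore makes the product vanish there. -/
theorem gapProd_op_apply (a : Λ.Obj) (L : List Λ.Path)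
    (ξ : Λ.BoundaryPath × (Fin k → ℤ) → R) (x : Λ.BoundaryPath) (n : Fin k → ℤ)
    (hL : vert a ∈ x.1.pre → ∃ l ∈ L, l ∈ x.1.pre) :
    gapProd (pathOp R) (ghostOp R) a L ξ (x, n) = 0 := by
  by_cases ha : vert a ∈ x.1.pre
  · obtain ⟨l, hl, hx⟩ := hL ha
    clear hL
    induction L with
    | nil => simp at hl
    | cons m L ih =>
      change (pathOp R (vert a) - pathOp R m * ghostOp R m)
        (gapProd (pathOp R) (ghostOp R) a L ξ) (x, n) = 0
      rw [LinearMap.sub_apply, Module.End.mul_apply, Pi.sub_apply, pathOp_vert ha]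
      rcases List.mem_cons.1 hl with rfl | hl
      · rw [path_ghostOp_of_mem hx, sub_self]
      · by_cases hm : m ∈ x.1.pre
        · rw [path_ghostOp_of_mem hm, sub_self]
        · rw [ih hl, pathOp_of_notMem hm, sub_self]
  · clear hL
    induction L with
    | nil => exact pathOp_of_notMem ha _ _
    | cons m L ih =>
      change (pathOp R (vert a) - pathOp R m * ghostOp R m)
        (gapProd (pathOp R) (ghostOp R) a L ξ) (x, n) = 0
      rw [LinearMap.sub_apply, Module.End.mul_apply, Pi.sub_apply, pathOp_of_notMem ha]
      by_cases hm : m ∈ x.1.pre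
      · rw [path_ghostOp_of_mem hm, ih, sub_self]
      · rw [pathOp_of_notMem hm, sub_self]

variable (Λ R) in
theorem isKPFamily_op : IsKPFamily (pathOp (Λ := Λ) R) (ghostOp R) where
  ghost_vert a := by
    refine LinearMap.ext fun ξ => funext fun ⟨x, n⟩ => ?_
    by_cases h : vert a ∈ x.1.pre
    · rw [pathOp_vert h, ghostOp_of_extends (extends_vert_iff.2 ⟨rfl, h⟩), zdeg_vert, add_zero]
    · rw [pathOp_of_notMem h, ghostOp_of_notMem h]
  idem a := by
    refine LinearMap.ext fun ξ => funext fun ⟨x, n⟩ => ?_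
    rw [Module.End.mul_apply]
    by_cases h : vert a ∈ x.1.pre
    · rw [pathOp_vert h]
    · rw [pathOp_of_notMem h, pathOp_of_notMem h]
  orth a b hab := by
    refine LinearMap.ext fun ξ => funext fun ⟨x, n⟩ => ?_
    rw [Module.End.mul_apply]
    by_cases h : vert a ∈ x.1.pre
    · rw [pathOp_vert h, pathOp_of_notMem fun h' =>
        hab (rng_eq_of_mem_pre (l := vert a) (l' := vert b) h h')]
      rfl
    · rw [pathOp_of_notMem h]
      rfl
  mul l m e := by
    refine LinearMap.ext fun ξ => funext fun ⟨x, n⟩ => ?_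
    rw [Module.End.mul_apply]
    by_cases h : l ∈ x.1.pre
    · obtain ⟨y, hy⟩ := exists_extends_tail h
      rw [pathOp_of_extends hy]
      by_cases h' : m ∈ y.1.pre
      · obtain ⟨w, hw⟩ := exists_extends_tail h'
        rw [pathOp_of_extends hw, pathOp_of_extends (hy.comp hw), zdeg_comp, sub_sub]
      · rw [pathOp_of_notMem h', pathOp_of_notMem fun h'' => h' (hy.mem_of_comp_mem h'')]
    · rw [pathOp_of_notMem h, pathOp_of_notMem fun h' => h (mem_pre_of_le (le_comp l m e) h')]
  ghost_mul l m e := by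
    refine LinearMap.ext fun ξ => funext fun ⟨x, n⟩ => ?_
    rw [Module.End.mul_apply]
    by_cases h : vert m.src ∈ x.1.pre
    · obtain ⟨y, hy⟩ := BoundaryPath.exists_extends h
      have hl : vert l.src ∈ y.1.pre := by
        rw [e]
        exact vert_rng_mem_pre hy.1
      obtain ⟨z, hz⟩ := BoundaryPath.exists_extends hl
      rw [ghostOp_of_extends hy, ghostOp_of_extends hz, ghostOp_of_extends (hz.comp hy),
        zdeg_comp, add_assoc, add_comm m.zdeg]
    · rw [ghostOp_of_notMem h, ghostOp_of_notMem (l := l.comp m e) h]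
  ghost_mul_path l m := by
    refine LinearMap.ext fun ξ => funext fun ⟨x, n⟩ => ?_
    rw [Module.End.mul_apply, LinearMap.sum_apply, Finset.sum_apply]
    by_cases hx : vert l.src ∈ x.1.pre
    · obtain ⟨z, hz⟩ := BoundaryPath.exists_extends hx
      rw [ghostOp_of_extends hz]
      by_cases hm : m ∈ z.1.pre
      · obtain ⟨y, hy⟩ := exists_extends_tail hm
        -- The prefix of `z = l x` of degree `d(l) ∨ d(m)` singles out the only pair of `Λ^min`
        -- whose term can be nonzero at `x`.
        obtain ⟨c, hc, h1, h2, -⟩ := exists_mem_pre_sup hz.1 hm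
        obtain ⟨p, hp, e, hle⟩ := exists_mem_minExt h1 h2
        obtain ⟨_, e', hpe, hpd⟩ := id hp
        have hlp := mem_pre_of_le hle hc
        obtain ⟨w, hw⟩ := exists_extends_tail (hz.mem_of_comp_mem hlp)
        have hmp : m.comp p.2 e' ∈ z.1.pre := hpe ▸ hlp
        obtain ⟨w', hw'⟩ := exists_extends_tail (hy.mem_of_comp_mem hmp)
        have hww : w = w' := by
          have h3 := hz.comp hw
          have h4 := hy.comp hw'
          rw [hpe] at h3
          exact Subtype.ext (h3.tail_unique h4)
        subst hww
        rw [pathOp_of_extends hy, Finset.sum_eq_single p]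
        · rw [Module.End.mul_apply, pathOp_of_extends hw, ghostOp_of_extends hw']
          have hd : l.zdeg + p.1.zdeg = m.zdeg + p.2.zdeg := by
            rw [← zdeg_comp l p.1 e, hpe, zdeg_comp]
          congr 2
          rw [sub_eq_iff_eq_add, add_assoc, add_comm p.2.zdeg, ← hd]
          abel
        · intro q hq hqp
          rw [Set.Finite.mem_toFinset] at hq
          rw [Module.End.mul_apply]
          refine pathOp_of_notMem (fun hq1 => hqp ?_) _ _
          obtain ⟨h₁, h₂, hqe, hqd⟩ := hq
          have h5 := eq_of_mem_pre (hz.comp_mem hq1) hlp (hqd.trans hpd.symm)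
          refine Prod.ext (comp_left_cancel h5) ?_
          rw [hqe, hpe] at h5
          exact comp_left_cancel h5
        · intro hp'
          rw [Set.Finite.mem_toFinset] at hp'
          exact (hp' hp).elim
      · rw [pathOp_of_notMem hm, Finset.sum_eq_zero]
        intro q hq
        rw [Set.Finite.mem_toFinset] at hq
        rw [Module.End.mul_apply]
        refine pathOp_of_notMem (fun hq1 => hm ?_) _ _
        obtain ⟨h₁, h₂, hqe, -⟩ := hq
        exact mem_pre_of_le ⟨_, h₂, hqe.symm⟩ (hz.comp_mem hq1)
    · rw [ghostOp_of_notMem hx, Finset.sum_eq_zero]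
      intro q hq
      rw [Set.Finite.mem_toFinset] at hq
      rw [Module.End.mul_apply]
      refine pathOp_of_notMem (fun hq1 => hx ?_) _ _
      obtain ⟨h₁, -⟩ := hq
      rw [h₁]
      exact vert_rng_mem_pre hq1
  exhaustive a E hE L hL := by
    refine LinearMap.ext fun ξ => funext fun ⟨x, n⟩ => gapProd_op_apply a L ξ x n fun ha => ?_
    obtain ⟨e, he, h', h⟩ := isBoundary_iff.1 x.2 _ ha E hE
    refine ⟨e, by rwa [← Multiset.mem_coe, hL], ?_⟩
    obtain rfl : a = e.rng := h'
    rwa [vert_comp] at h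

variable (Λ R) in
/-- The representation of the Kumjian-Pask algebra on the functions on `∂Λ × ℤ^k`. -/
def opHom : KumjianPask Λ R →ₙₐ[R] Module.End R (Λ.BoundaryPath × (Fin k → ℤ) → R) :=
  (KumjianPask.existsUnique_lift R _ _ (isKPFamily_op Λ R)).choose

theorem opHom_path (l : Λ.Path) : opHom Λ R (.path R l) = pathOp R l :=
  (KumjianPask.existsUnique_lift R _ _ (isKPFamily_op Λ R)).choose_spec.1.1 l

theorem opHom_ghost (l : Λ.Path) : opHom Λ R (.ghost R l) = ghostOp R l :=
  (KumjianPask.existsUnique_lift R _ _ (isKPFamily_op Λ R)).choose_spec.1.2 l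

open Classical in
variable (Λ R) in
/-- The kernels of the operators `opHom Λ R a`, as functions on the boundary-path groupoid. -/
def toFun : KumjianPask Λ R →ₗ[R] (GroupoidArrow Λ.BoundaryPath → R) where
  toFun a g := opHom Λ R a (Pi.single (g.src, 0) 1) (g.rng, g.hom.1)
  map_add' a b := by
    funext g
    simp
  map_smul' r a := by
    funext g
    simp

/-- At `(x, n)` the operator evaluates its argument at `(m w, n - d(l) + d(m))` if `x = l w` and `m
w` is defined, and gives 0 otherwise. A point mass at `(y, 0)` thus tests membership in `Z l m`. -/
theorem toFun_path_mul_ghost (l m : Λ.Path) :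
    toFun Λ R (.path R l * .ghost R m) = (Z l m).indicator 1 := by
  classical
  funext g
  change opHom Λ R (.path R l * .ghost R m) (Pi.single (g.src, 0) 1) (g.rng, g.hom.1) = _
  rw [map_mul, opHom_path, opHom_ghost, Module.End.mul_apply]
  by_cases hg : g ∈ Z l m
  · rw [Set.indicator_of_mem hg]
    obtain ⟨w, h1, h2, h3⟩ := mem_Z_iff.1 hg
    rw [pathOp_of_extends h1, ghostOp_of_extends h2, h3,
      show l.zdeg - m.zdeg - l.zdeg + m.zdeg = 0 by abel, Pi.single_eq_same]
    rfl
  · rw [Set.indicator_of_notMem hg]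
    by_cases hl : l ∈ g.rng.1.pre
    · obtain ⟨w, hw⟩ := exists_extends_tail hl
      rw [pathOp_of_extends hw]
      by_cases hm : vert m.src ∈ w.1.pre
      · obtain ⟨y, hy⟩ := BoundaryPath.exists_extends hm
        rw [ghostOp_of_extends hy]
        refine Pi.single_eq_of_ne (fun he => hg (mem_Z_iff.2 ?_)) _
        obtain ⟨rfl, he⟩ := Prod.ext_iff.1 he
        refine ⟨w, hw, hy, ?_⟩
        simp only at he
        rw [← sub_eq_zero, ← he]
        abel
      · rw [ghostOp_of_notMem hm]
    · rw [pathOp_of_notMem hl]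

theorem toFun_path (l : Λ.Path) : toFun Λ R (.path R l) = (Z l (vert l.src)).indicator 1 := by
  have hF := KumjianPask.isKPFamily (Λ := Λ) R
  rw [← toFun_path_mul_ghost, hF.ghost_vert, hF.path_mul_vert]

theorem toFun_ghost (l : Λ.Path) : toFun Λ R (.ghost R l) = (Z (vert l.src) l).indicator 1 := by
  have hF := KumjianPask.isKPFamily (Λ := Λ) R
  rw [← toFun_path_mul_ghost, hF.vert_mul_ghost]

/-- The operators `opHom Λ R a` are given by the kernels `toFun Λ R a`. -/
theorem opHom_apply (a : KumjianPask Λ R) (ξ : Λ.BoundaryPath × (Fin k → ℤ) → R)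
    (x : Λ.BoundaryPath) (n : Fin k → ℤ) :
    (Function.support fun b : Σ t : Λ.BoundaryPath, (t ⟶ x) =>
      toFun Λ R a ⟨b.1, x, b.2⟩ * ξ (b.1, n - b.2.1)).Finite ∧
    opHom Λ R a ξ (x, n) = ∑ᶠ b : Σ t : Λ.BoundaryPath, (t ⟶ x),
      toFun Λ R a ⟨b.1, x, b.2⟩ * ξ (b.1, n - b.2.1) := by
  have ha := Submodule.mem_top (R := R) (x := a)
  rw [← KumjianPask.span_path_mul_ghost Λ R] at ha
  induction ha using Submodule.span_induction with
  | mem a ha =>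
    obtain ⟨⟨⟨l, m⟩, hlm⟩, rfl⟩ := ha
    simp only at hlm ⊢
    rw [toFun_path_mul_ghost, map_mul, opHom_path, opHom_ghost, Module.End.mul_apply]
    by_cases hl : l ∈ x.1.pre
    · obtain ⟨w, hw⟩ := exists_extends_tail hl
      obtain ⟨y, hy⟩ := BoundaryPath.exists_extends (l := m) (w := w) (hlm ▸ hw.vert_mem)
      -- The only arrow of `Z l m` with range `x = l w`; the sum has this single term.
      let b₀ : Σ t : Λ.BoundaryPath, (t ⟶ x) := ⟨y, (extArrow hw hy).hom⟩
      have hb : ∀ b : Σ t : Λ.BoundaryPath, (t ⟶ x), b ≠ b₀ →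
          (Z l m).indicator (1 : GroupoidArrow Λ.BoundaryPath → R) ⟨b.1, x, b.2⟩ * ξ (b.1, n - b.2.1) = 0 := by
        intro b hb
        rw [Set.indicator_of_notMem, zero_mul]
        intro hZ
        obtain ⟨w', h1, h2, h3⟩ := mem_Z_iff.1 hZ
        obtain rfl : w = w' := Subtype.ext (hw.tail_unique h1)
        obtain ⟨t, f⟩ := b
        obtain rfl : y = t := Subtype.ext (hy.unique h2)
        exact hb (congrArg (Sigma.mk y) (Subtype.ext h3))
      refine ⟨(Set.finite_singleton b₀).subset fun b hb' => ?_, ?_⟩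
      · by_contra hne
        exact hb' (hb b hne)
      · rw [finsum_eq_single _ b₀ hb, Set.indicator_of_mem, Pi.one_apply, one_mul,
          pathOp_of_extends hw, ghostOp_of_extends hy]
        · change _ = ξ (y, n - (l.zdeg - m.zdeg))
          congr 2
          abel
        · exact mem_Z_iff.2 ⟨w, hw, hy, rfl⟩
    · have h0 : (fun b : Σ t : Λ.BoundaryPath, (t ⟶ x) =>
          (Z l m).indicator (1 : GroupoidArrow Λ.BoundaryPath → R) ⟨b.1, x, b.2⟩ * ξ (b.1, n - b.2.1)) = 0 := by
        funext b
        rw [Set.indicator_of_notMem, zero_mul]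
        · rfl
        · intro hZ
          exact hl (mem_Z_iff.1 hZ).choose_spec.1.1
      rw [h0, pathOp_of_notMem hl]
      exact ⟨by simp, finsum_zero.symm⟩
  | zero => simp
  | add a b _ _ h1 h2 =>
    simp only [map_add, Pi.add_apply, add_mul, LinearMap.add_apply]
    refine ⟨(h1.1.union h2.1).subset (Function.support_add _ _), ?_⟩
    rw [finsum_add_distrib h1.1 h2.1, h1.2, h2.2]
  | smul r a _ h =>
    simp only [map_smul, Pi.smul_apply, smul_eq_mul, mul_assoc, LinearMap.smul_apply]
    refine ⟨h.1.subset fun b hb => right_ne_zero_of_mul hb, ?_⟩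
    rw [h.2, mul_finsum' _ _ h.1]

/-- Apply the kernel formula for `a` to the image under `b` of the point mass at `(s(g), 0)`. -/
theorem convTerm_toFun (a b : KumjianPask Λ R) (g : GroupoidArrow Λ.BoundaryPath) :
    (Function.support (convTerm (toFun Λ R a) (toFun Λ R b) g)).Finite ∧
      toFun Λ R (a * b) g = convolution (toFun Λ R a) (toFun Λ R b) g := by
  classical
  have := opHom_apply a (opHom Λ R b (Pi.single (g.src, 0) 1)) g.rng g.hom.1
  have hc : (fun c : Σ t : Λ.BoundaryPath, (t ⟶ g.rng) => toFun Λ R a ⟨c.1, g.rng, c.2⟩ *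
      opHom Λ R b (Pi.single (g.src, 0) 1) (c.1, g.hom.1 - c.2.1)) =
      convTerm (toFun Λ R a) (toFun Λ R b) g := by
    funext c
    -- The degree of `c⁻¹g` is by definition `-c + g`.
    rw [← neg_add_eq_sub]
    rfl
  rw [hc] at this
  refine ⟨this.1, Eq.trans ?_ this.2⟩
  change opHom Λ R (a * b) _ _ = _
  rw [map_mul, Module.End.mul_apply]

end Rep

end KGraph

/-- A nonzero vector is not annihilated by the complement of some prime ideal of the commutative
ring generated by a commuting family of endomorphisms. -/
theorem exists_isPrime_of_commute {ι R : Type*} {M : Type u} [CommRing R] [AddCommGroup M]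
    [Module R M] (e : ι → Module.End R M) (he : ∀ i j, e i * e j = e j * e i) {a : M}
    (ha : a ≠ 0) : ∃ (C : Type u) (_ : CommRing C) (f : C →+* Module.End R M) (E : ι → C)
      (P : Ideal C), Function.Injective f ∧ (∀ i, f (E i) = e i) ∧ P.IsPrime ∧
        ∀ c, f c a = 0 → c ∈ P := by
  have hcomm : ∀ b ∈ Algebra.adjoin R (Set.range e), ∀ c ∈ Algebra.adjoin R (Set.range e),
      b * c = c * b := fun b hb c hc =>
    congrArg Subtype.val ((Algebra.isMulCommutative_adjoin R (s := Set.range e) (by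
      rintro _ ⟨i, rfl⟩ _ ⟨j, rfl⟩
      exact he i j)).is_comm.comm ⟨b, hb⟩ ⟨c, hc⟩)
  let _ : CommRing (Algebra.adjoin R (Set.range e)) :=
    { (inferInstance : Ring (Algebra.adjoin R (Set.range e))) with
      mul_comm := fun b c => Subtype.ext (hcomm b b.2 c c.2) }
  let f : Algebra.adjoin R (Set.range e) →+* Module.End R M :=
    { toFun := Subtype.val
      map_one' := rfl
      map_mul' := fun _ _ => rfl
      map_zero' := rfl
      map_add' := fun _ _ => rfl }
  let J : Ideal (Algebra.adjoin R (Set.range e)) :=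
    { carrier := {c | f c a = 0}
      add_mem' := fun {c d} hc hd => by
        change f c a = 0 at hc
        change f d a = 0 at hd
        change f (c + d) a = 0
        rw [map_add, LinearMap.add_apply, hc, hd, add_zero]
      zero_mem' := by
        change f 0 a = 0
        rw [map_zero, LinearMap.zero_apply]
      smul_mem' := fun c d hd => by
        change f d a = 0 at hd
        change f (c * d) a = 0
        rw [map_mul, Module.End.mul_apply, hd, map_zero] }
  -- The annihilator of `a` is proper, since 1 does not kill `a`; a maximal ideal above it serves as
  -- `P`.
  have hJ : J ≠ ⊤ := by
    rw [Ideal.ne_top_iff_one]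
    intro h
    change f 1 a = 0 at h
    rw [map_one, Module.End.one_apply] at h
    exact ha h
  obtain ⟨P, hP, hJP⟩ := J.exists_le_maximal hJ
  exact ⟨Algebra.adjoin R (Set.range e), inferInstance, f, fun i => ⟨e i, Algebra.subset_adjoin ⟨i, rfl⟩⟩, P,
    Subtype.val_injective, fun _ => rfl, hP.isPrime, fun c hc => hJP hc⟩

theorem mulLeft_mul_eq (R : Type*) {A : Type*} [CommRing R] [NonUnitalRing A] [Module R A]
    [IsScalarTower R A A] [SMulCommClass R A A] (a b : A) :
    LinearMap.mulLeft R (a * b) = LinearMap.mulLeft R a * LinearMap.mulLeft R b :=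
  LinearMap.ext fun c => mul_assoc a b c

namespace KGraph

variable {k : ℕ} {Λ : KGraph.{u, v} k}

open KGraph.Path KGraph.OmegaPath KGraph.BoundaryPath

/-! ### The diagonal projections -/

namespace IsKPFamily

variable [Λ.FinitelyAligned] {A : Type*} [NonUnitalRing A] {S T : Λ.Path → A}

theorem proj_mul_path (h : IsKPFamily S T) (l t : Λ.Path) (e : l.src = t.rng) :
    S l * T l * S (l.comp t e) = S (l.comp t e) := by
  rw [← h.mul l t e, mul_assoc, ← mul_assoc (T l), h.ghost_mul_self, ← mul_assoc,
    h.path_mul_vert]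

theorem proj_mul_proj_of_le (h : IsKPFamily S T) {l p : Λ.Path} (hlp : l ≤ p) :
    S l * T l * (S p * T p) = S p * T p := by
  obtain ⟨t, e, rfl⟩ := hlp
  rw [← mul_assoc, h.proj_mul_path]

theorem proj_comp_mul (h : IsKPFamily S T) (l m t : Λ.Path) (e : l.src = t.rng)
    (e' : m.src = t.rng) :
    S (l.comp t e) * T (l.comp t e) * (S l * T m) = S (l.comp t e) * T (m.comp t e') := by
  rw [← h.ghost_mul l t e, ← h.ghost_mul m t e', mul_assoc, mul_assoc, ← mul_assoc (T l),
    h.ghost_mul_self, (congrArg vert (e.trans e'.symm) : vert l.src = vert m.src),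
    h.vert_mul_ghost]

/-- The terms in the expansion of a product of two diagonal projections are again diagonal
projections. The expansion is symmetric under swapping pairs of `Λ^min`, whence commutativity. -/
theorem proj_mul_proj_term (h : IsKPFamily S T) {l m : Λ.Path} {p : Λ.Path × Λ.Path}
    {h₁ : l.src = p.1.rng} {h₂ : m.src = p.2.rng} (hp : l.comp p.1 h₁ = m.comp p.2 h₂) :
    S l * (S p.1 * T p.2) * T m = S (l.comp p.1 h₁) * T (l.comp p.1 h₁) := by
  rw [← mul_assoc, h.mul l p.1 h₁, mul_assoc, h.ghost_mul m p.2 h₂, hp]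

theorem proj_mul_proj (h : IsKPFamily S T) (l m : Λ.Path) :
    S l * T l * (S m * T m) =
      ∑ p ∈ (FinitelyAligned.finite_minExt l m).toFinset, S l * (S p.1 * T p.2) * T m := by
  rw [mul_assoc, ← mul_assoc (T l), h.ghost_mul_path, Finset.sum_mul, Finset.mul_sum]
  exact Finset.sum_congr rfl fun p _ => (mul_assoc _ _ _).symm

theorem proj_comm (h : IsKPFamily S T) (l m : Λ.Path) :
    S l * T l * (S m * T m) = S m * T m * (S l * T l) := by
  rw [h.proj_mul_proj, h.proj_mul_proj]
  refine Finset.sum_nbij' Prod.swap Prod.swap ?_ ?_ (fun _ _ => rfl) (fun _ _ => rfl) ?_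
  · intro p hp
    rw [Set.Finite.mem_toFinset] at hp ⊢
    exact minExt_swap hp
  · intro p hp
    rw [Set.Finite.mem_toFinset] at hp ⊢
    exact minExt_swap hp
  · intro p hp
    rw [Set.Finite.mem_toFinset] at hp
    obtain ⟨h₁, h₂, e, -⟩ := hp
    rw [h.proj_mul_proj_term e, h.proj_mul_proj_term (p := p.swap) (h₁ := h₂) (h₂ := h₁) e.symm]
    rw [e]
    rfl

theorem vert_mul_gapProd (h : IsKPFamily S T) (a : Λ.Obj) (L : List Λ.Path)
    (hL : ∀ l ∈ L, l.rng = a) : S (vert a) * gapProd S T a L = gapProd S T a L := by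
  cases L with
  | nil => exact h.idem a
  | cons l L =>
    obtain rfl := hL l (by simp)
    change S _ * ((S _ - S l * T l) * _) = (S _ - S l * T l) * _
    rw [← mul_assoc, mul_sub, h.idem, ← mul_assoc, h.vert_mul_path]

/-- A new factor `l` in the gap product amounts to left multiplication of `S_p ∏` by `1 - S_{pl}
T_{pl}`. So `S_p ∏ T_p` is a polynomial in diagonal projections, and an ideal of the diagonal can
test it. -/
theorem path_mul_gapProd_cons (h : IsKPFamily S T) (p l : Λ.Path) (L : List Λ.Path)
    (e : p.src = l.rng) (hL : ∀ l ∈ L, l.rng = p.src) :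
    S p * gapProd S T p.src (l :: L) = S p * gapProd S T p.src L -
      S (p.comp l e) * T (p.comp l e) * (S p * gapProd S T p.src L) := by
  have h1 : S (p.comp l e) * T (p.comp l e) * (S p * gapProd S T p.src L) =
      S p * S l * T l * gapProd S T p.src L := by
    rw [← h.ghost_mul p l e, mul_assoc, mul_assoc (T l), ← mul_assoc (T p), h.ghost_mul_self,
      h.vert_mul_gapProd _ _ hL, ← h.mul p l e, mul_assoc (S p * S l)]
  rw [h1]
  change S p * ((S _ - S l * T l) * gapProd S T p.src L) = _
  rw [sub_mul, mul_sub, h.vert_mul_gapProd _ _ hL]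
  simp only [mul_assoc]

end IsKPFamily

/-! ### Injectivity -/

section Injective

variable {R : Type w} [CommRing R] [Λ.FinitelyAligned]

/-- The prime ideals of the diagonal give rise to boundary paths. -/
theorem exists_boundaryPath_of_isPrime {C : Type*} [CommRing C]
    (f : C →+* Module.End R (KumjianPask Λ R)) (hf : Function.Injective f) (E : Λ.Path → C)
    (hE : ∀ l, f (E l) = LinearMap.mulLeft R (.path R l * .ghost R l)) (P : Ideal C) (hP : P.IsPrime)
    (hne : ∃ l, E l ∉ P) : ∃ x : Λ.BoundaryPath, ∀ l, l ∈ x.1.pre ↔ E l ∉ P := by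
  have hF := KumjianPask.isKPFamily (Λ := Λ) R
  have hle : ∀ l p, l ≤ p → E l * E p = E p := by
    intro l p hlp
    apply hf
    rw [map_mul, hE, hE, ← mulLeft_mul_eq, hF.proj_mul_proj_of_le hlp]
  obtain ⟨x, hx⟩ := exists_pre_eq {l | E l ∉ P} hne
    (fun l p hlp hp hl => hp (by
      rw [← hle l p hlp]
      exact P.mul_mem_right _ hl)) (by
      intro l hl m hm
      by_contra! hc
      refine (hP.mul_notMem hl hm) ?_
      -- If no common extension of `l` and `m` is outside `P`, then each term of the expansion of `E
      -- l * E m` lies in `P`, and so does the product.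
      have hterm : ∀ p : Λ.Path × Λ.Path, ∃ c : C, p ∈ minExt l m →
          f c = LinearMap.mulLeft R (.path R l * (.path R p.1 * .ghost R p.2) * .ghost R m) ∧
            c ∈ P := by
        intro p
        by_cases hp : p ∈ minExt l m
        · obtain ⟨h₁, h₂, e, -⟩ := hp
          refine ⟨E (l.comp p.1 h₁), fun _ => ⟨?_, ?_⟩⟩
          · rw [hE, hF.proj_mul_proj_term e]
          · by_contra hq
            exact hc _ hq (le_comp _ _ _) ⟨_, h₂, e.symm⟩
        · exact ⟨0, fun h => (hp h).elim⟩
      choose c hc using hterm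
      have : E l * E m = ∑ p ∈ (FinitelyAligned.finite_minExt l m).toFinset, c p := by
        apply hf
        rw [map_mul, hE, hE, map_sum]
        refine LinearMap.ext fun b => ?_
        rw [Module.End.mul_apply, LinearMap.sum_apply, LinearMap.mulLeft_apply,
          LinearMap.mulLeft_apply, ← mul_assoc, hF.proj_mul_proj, Finset.sum_mul]
        refine Finset.sum_congr rfl fun p hp => ?_
        rw [(hc p ((Set.Finite.mem_toFinset _).1 hp)).1, LinearMap.mulLeft_apply]
      rw [this]
      exact P.sum_mem fun p hp => (hc p ((Set.Finite.mem_toFinset _).1 hp)).2)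
  refine ⟨⟨x, isBoundary_iff.2 ?_⟩, fun l => by rw [hx]; rfl⟩
  intro p hp F hFE
  by_contra! hc
  rw [hx] at hp hc
  -- If the boundary condition fails at `p` and `F`, all `E (p l)` with `l ∈ F` lie in `P`, so `E p`
  -- times the product of the `1 - E (p l)` stays outside the prime `P`. By (KP4) this element is
  -- zero.
  have key : ∀ L : List Λ.Path, (∀ l ∈ L, l ∈ F) → ∃ c : C, c ∉ P ∧
      f c = LinearMap.mulLeft R
        (KumjianPask.path R p * gapProd (KumjianPask.path R) (KumjianPask.ghost R) p.src L *
          KumjianPask.ghost R p) := by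
    intro L hL
    induction L with
    | nil =>
      refine ⟨E p, hp, ?_⟩
      change _ = LinearMap.mulLeft R (KumjianPask.path R p * .path R (vert p.src) * .ghost R p)
      rw [hE, hF.path_mul_vert]
    | cons l L ih =>
      obtain ⟨c, hcP, hcf⟩ := ih fun l' hl' => hL l' (List.mem_cons_of_mem _ hl')
      have hlF : l ∈ F := hL l (by simp)
      have e : p.src = l.rng := ((hFE.1 l hlF).1).symm
      have hlP : E (p.comp l e) ∈ P := by
        by_contra h
        exact hc l hlF e h
      refine ⟨(1 - E (p.comp l e)) * c, hP.mul_notMem (fun h => ?_) hcP, ?_⟩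
      · exact hP.ne_top ((Ideal.eq_top_iff_one P).2 (by simpa using P.add_mem h hlP))
      · rw [map_mul, map_sub, map_one, hcf, hE, hF.path_mul_gapProd_cons p l L e fun l' hl' =>
          (hFE.1 l' (hL l' (List.mem_cons_of_mem _ hl'))).1]
        refine LinearMap.ext fun b => ?_
        simp only [Module.End.mul_apply, LinearMap.sub_apply, Module.End.one_apply,
          LinearMap.mulLeft_apply, sub_mul, mul_assoc]
  obtain ⟨c, hcP, hcf⟩ := key F.toList fun l hl => Finset.mem_toList.1 hl
  rw [hF.exhaustive p.src F hFE F.toList (Finset.coe_toList F), mul_zero, zero_mul,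
    LinearMap.mulLeft_zero_eq_zero, ← map_zero f] at hcf
  exact hcP (hf hcf ▸ P.zero_mem)

variable (Λ R) in
theorem toFun_injective : Function.Injective (toFun Λ R) := by
  classical
  rw [injective_iff_map_eq_zero]
  intro a ha
  by_contra hne
  have hF := KumjianPask.isKPFamily (Λ := Λ) R
  obtain ⟨C, _, f, E, P, hf, hE, hP, hann⟩ := exists_isPrime_of_commute
    (fun l : Λ.Path => LinearMap.mulLeft R (KumjianPask.path R l * .ghost R l))
    (fun l m => by rw [← mulLeft_mul_eq, ← mulLeft_mul_eq, hF.proj_comm]) hne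
  have hspan := Submodule.mem_top (R := R) (x := a)
  rw [← KumjianPask.span_path_mul_ghost Λ R, Finsupp.mem_span_range_iff_exists_finsupp] at hspan
  obtain ⟨c, hc⟩ := hspan
  obtain ⟨v, hv⟩ : ∃ v : {p : Λ.Path × Λ.Path // p.1.src = p.2.src} → KumjianPask Λ R,
      ∀ p, v p = .path R p.1.1 * .ghost R p.1.2 := ⟨_, fun _ => rfl⟩
  simp only [← hv] at hc
  set s := c.support.filter fun i => E i.1.1 ∉ P with hs
  -- `Q` kills the terms whose `λ_i` will not be a prefix of `x`, because `E λ_i` fixes `s_{λ_i}`.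
  -- It is outside `P`, since each of its factors is 1 minus an element of `P`.
  set Q : C := ∏ i ∈ c.support.filter (fun i => E i.1.1 ∈ P), (1 - E i.1.1) with hQ
  have hQP : Q ∉ P := by
    rw [hQ, hP.prod_mem_iff]
    rintro ⟨i, hi, h⟩
    have hi := (Finset.mem_filter.1 hi).2
    exact hP.ne_top ((Ideal.eq_top_iff_one P).2 (by simpa using P.add_mem h hi))
  have hQv : ∀ i ∈ c.support, E i.1.1 ∈ P → f Q (v i) = 0 := by
    intro i hi hiP
    have : f (1 - E i.1.1) (v i) = 0 := by
      rw [hv, map_sub, map_one, hE, LinearMap.sub_apply, LinearMap.mulLeft_apply, Module.End.one_apply,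
        ← mul_assoc, mul_assoc (KumjianPask.path R i.1.1), hF.ghost_mul_self, hF.path_mul_vert,
        sub_self]
    rw [hQ, ← Finset.prod_erase_mul _ _ (Finset.mem_filter.2 ⟨hi, hiP⟩), map_mul,
      Module.End.mul_apply, this, map_zero]
  have hQa : f Q a = ∑ i ∈ s, c i • f Q (v i) := by
    rw [← hc, Finsupp.sum, map_sum, hs, Finset.sum_filter]
    refine Finset.sum_congr rfl fun i hi => ?_
    by_cases h : E i.1.1 ∈ P
    · rw [if_neg (not_not.2 h), map_smul, hQv i hi h, smul_zero]
    · rw [if_pos h, map_smul]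
  -- Otherwise `Q` would kill every term of `a`, although `Q ∉ P`.
  have hSne : ∃ l, E l ∉ P := by
    by_contra! hall
    refine hQP (hann Q ?_)
    rw [hQa, hs, Finset.filter_false_of_mem fun i _ => not_not.2 (hall _), Finset.sum_empty]
  obtain ⟨x, hx⟩ := exists_boundaryPath_of_isPrime f hf E hE P hP hSne
  have hub : ∀ t : Finset {p : Λ.Path × Λ.Path // p.1.src = p.2.src},
      (∀ i ∈ t, i.1.1 ∈ x.1.pre) → ∃ p ∈ x.1.pre, ∀ i ∈ t, i.1.1 ≤ p := by
    intro t
    induction t using Finset.induction_on with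
    | empty =>
      obtain ⟨b, hb⟩ := x.1.exists_vert_mem_pre
      exact fun _ => ⟨_, hb, by simp⟩
    | insert i t _ ih =>
      intro h
      obtain ⟨p, hp, h'⟩ := ih fun j hj => h j (Finset.mem_insert_of_mem hj)
      obtain ⟨q, hq, h1, h2, -⟩ := exists_mem_pre_sup hp (h i (Finset.mem_insert_self _ _))
      refine ⟨q, hq, fun j hj => ?_⟩
      rcases Finset.mem_insert.1 hj with rfl | hj
      · exact h2
      · exact (h' j hj).trans h1
  -- A prefix `p` of `x` extending every remaining `λ_i`. Writing `p = λ_i ν_i`, set `o i = μ_i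
  -- ν_i`; then `E p` turns the term `s_{λ_i} s_{μ_i*}` into `s_p s_{o_i*}`.
  obtain ⟨p, hp, hps⟩ := hub s fun i hi => (hx _).2 (Finset.mem_filter.1 hi).2
  have hex : ∀ i : {p : Λ.Path × Λ.Path // p.1.src = p.2.src}, ∃ o : Λ.Path, i ∈ s →
      ∃ (n : Λ.Path) (h₁ : i.1.1.src = n.rng) (h₂ : i.1.2.src = n.rng),
        p = i.1.1.comp n h₁ ∧ o = i.1.2.comp n h₂ := by
    intro i
    by_cases hi : i ∈ s
    · obtain ⟨n, h, e⟩ := hps i hi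
      exact ⟨i.1.2.comp n (i.2.symm.trans h), fun _ => ⟨n, h, i.2.symm.trans h, e.symm, rfl⟩⟩
    · exact ⟨p, fun h => (hi h).elim⟩
  choose o ho using hex
  have hpv : ∀ i ∈ s, f (E p) (v i) = .path R p * .ghost R (o i) := by
    intro i hi
    obtain ⟨n, h₁, h₂, e, e'⟩ := ho i hi
    rw [hE, LinearMap.mulLeft_apply, e', e, hv, hF.proj_comp_mul _ _ _ _ h₂]
  obtain ⟨w, hw⟩ := exists_extends_tail hp
  -- With `x = p w` and `y = (o i₀) w`, this sum is the value of `toFun a` at the arrow from `y` to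
  -- `x` in `Z p (o i₀)`: that arrow lies in `Z(λ_i *_s μ_i)` exactly when `i ∈ s` and `o i = o i₀`.
  have hcoef : ∀ i₀ ∈ s, ∑ i ∈ s with o i = o i₀, c i = 0 := by
    intro i₀ hi₀
    have hsrc : (o i₀).src = p.src := by
      obtain ⟨n, h₁, h₂, e, e'⟩ := ho i₀ hi₀
      rw [e', e]
      rfl
    obtain ⟨y, hy⟩ := BoundaryPath.exists_extends (l := o i₀) (w := w) (hsrc ▸ hw.vert_mem)
    obtain ⟨g, hg, hgx⟩ : ∃ g, g ∈ Z p (o i₀) ∧ g.rng = x :=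
      ⟨extArrow hw hy, mem_Z_iff.2 ⟨w, hw, hy, rfl⟩, rfl⟩
    have h0 := congrFun ha g
    rw [← hc, Finsupp.sum, map_sum, Finset.sum_apply, Pi.zero_apply] at h0
    rw [← h0, hs, Finset.filter_filter, Finset.sum_filter]
    refine Finset.sum_congr rfl fun i hi => ?_
    rw [map_smul, Pi.smul_apply, hv, toFun_path_mul_ghost]
    split_ifs with h
    · obtain ⟨n, h₁, h₂, e, e'⟩ := ho i (Finset.mem_filter.2 ⟨hi, h.1⟩)
      rw [Set.indicator_of_mem, Pi.one_apply, smul_eq_mul, mul_one]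
      rw [← h.2, e'] at hg
      rw [e] at hg
      exact mem_Z_of_mem_Z_comp hg
    · rw [Set.indicator_of_notMem, smul_zero]
      intro hZ
      have hiP := (hx i.1.1).1 (hgx ▸ (mem_Z_iff.1 hZ).choose_spec.1.1)
      obtain ⟨n, h₁, h₂, e, e'⟩ := ho i (Finset.mem_filter.2 ⟨hi, hiP⟩)
      refine h ⟨hiP, ?_⟩
      rw [e] at hg
      rw [e', eq_comp_of_mem_Z h₂ hZ hg]
  have hsum : ∑ i ∈ s, c i • (KumjianPask.path R p * .ghost R (o i)) = 0 := by
    rw [← Finset.sum_fiberwise_of_maps_to (t := s.image o) fun i hi => Finset.mem_image_of_mem o hi]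
    refine Finset.sum_eq_zero fun q hq => ?_
    obtain ⟨i₀, hi₀, rfl⟩ := Finset.mem_image.1 hq
    rw [Finset.sum_congr rfl (g := fun i => c i • (KumjianPask.path R p * .ghost R (o i₀)))
      fun i hi => by rw [(Finset.mem_filter.1 hi).2], ← Finset.sum_smul, hcoef i₀ hi₀, zero_smul]
  -- `E p * Q` is outside `P`, yet it is about to be shown to kill `a`.
  refine hP.mul_notMem ((hx p).1 hp) hQP (hann _ ?_)
  rw [map_mul, Module.End.mul_apply, hQa, map_sum]
  have : ∀ i ∈ s, f (E p) (c i • f Q (v i)) =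
      f Q (c i • (KumjianPask.path R p * .ghost R (o i))) := by
    intro i hi
    rw [map_smul, map_smul, ← hpv i hi, ← Module.End.mul_apply, ← Module.End.mul_apply, ← map_mul,
      ← map_mul, mul_comm]
  rw [Finset.sum_congr rfl this, ← map_sum, hsum, map_zero]

end Injective

open Topology

/-! ### The topology of the boundary-path groupoid -/

/-- The set `Z(λν *_s μν)`, which is empty unless `s(λ) = r(ν) = s(μ)`. -/
def ZExt (l m n : Λ.Path) : Set (GroupoidArrow Λ.BoundaryPath) :=
  {a | ∃ (h : l.src = n.rng) (h' : m.src = n.rng), a ∈ Z (l.comp n h) (m.comp n h')}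

theorem mem_ZExt_iff {l m n : Λ.Path} {a : GroupoidArrow Λ.BoundaryPath}
    {w : Λ.OmegaPath} (h : a ∈ Z l m) (hw : Extends l w a.rng.1) :
    a ∈ ZExt l m n ↔ n ∈ w.pre := by
  constructor
  · rintro ⟨e, e', h'⟩
    exact (mem_Z_comp_iff h hw e e').1 h'
  · intro hn
    have e := hw.rng_eq hn
    have e' := (src_eq_of_mem_Z h).symm.trans e
    exact ⟨e, e', (mem_Z_comp_iff h hw e e').2 hn⟩

theorem ZExt_subset (l m n : Λ.Path) : ZExt l m n ⊆ Z l m := by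
  rintro a ⟨e, e', h⟩
  exact mem_Z_of_mem_Z_comp h

theorem ZExt_anti (l m : Λ.Path) {n p : Λ.Path} (h : n ≤ p) : ZExt l m p ⊆ ZExt l m n := by
  intro a ha
  have hZ := ZExt_subset _ _ _ ha
  obtain ⟨w, hw, -⟩ := mem_Z_iff.1 hZ
  rw [mem_ZExt_iff hZ hw] at ha ⊢
  exact mem_pre_of_le h ha

theorem ZExt_vert (l m : Λ.Path) : ZExt l m (vert l.src) = Z l m := by
  refine (ZExt_subset _ _ _).antisymm fun a ha => ?_
  obtain ⟨w, hw, -⟩ := mem_Z_iff.1 ha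
  exact (mem_ZExt_iff ha hw).2 hw.vert_mem

theorem ZExt_eq_or (l m n : Λ.Path) :
    ZExt l m n = ∅ ∨ ∃ l' m' : Λ.Path, ZExt l m n = Z l' m' := by
  by_cases h : l.src = n.rng ∧ m.src = n.rng
  · exact .inr ⟨l.comp n h.1, m.comp n h.2, Set.ext fun a => ⟨fun ⟨_, _, ha⟩ => ha,
      fun ha => ⟨h.1, h.2, ha⟩⟩⟩
  · exact .inl (Set.eq_empty_of_forall_notMem fun a ⟨h1, h2, _⟩ => h ⟨h1, h2⟩)

theorem mem_ZDiff_iff {l m : Λ.Path} {G : Set Λ.Path} {a : GroupoidArrow Λ.BoundaryPath} :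
    a ∈ ZDiff l m G ↔ a ∈ Z l m ∧ ∀ n ∈ G, a ∉ ZExt l m n := by
  simp only [ZDiff, Set.mem_sdiff, Set.mem_iUnion, not_exists]
  rfl

/-- The indices `ν` such that `Z(λ *_s μ) ∩ Z(λ' *_s μ')` is the union of the sets
`Z(λν *_s μν)`. -/
def meetSet (l m l' m' : Λ.Path) : Set Λ.Path :=
  {n | ∃ s, (n, s) ∈ minExt l l' ∧ ∃ (h : m.src = n.rng) (h' : m'.src = s.rng),
    m.comp n h = m'.comp s h'}

theorem mem_inter_iff_meetSet {l m l' m' : Λ.Path} (h : l.src = m.src) (h' : l'.src = m'.src)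
    {a : GroupoidArrow Λ.BoundaryPath} :
    a ∈ Z l m ∧ a ∈ Z l' m' ↔ ∃ n ∈ meetSet l m l' m', a ∈ ZExt l m n := by
  rw [mem_Z_inter_iff h h']
  constructor
  · rintro ⟨⟨n, s⟩, hp, h₁, h₂, h₃, e, ha⟩
    exact ⟨n, ⟨s, hp, h₂, h₃, e⟩, h₁, h₂, ha⟩
  · rintro ⟨n, ⟨s, hp, h₂, h₃, e⟩, h₁, _, ha⟩
    exact ⟨(n, s), hp, h₁, h₂, h₃, e, ha⟩

/-- All `l n` here have degree `d(l) ∨ d(l')`, and the range of `a` has one prefix of each degree.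
So the pieces of the intersection are disjoint. -/
theorem eq_of_mem_meetSet {l m l' m' n n' : Λ.Path} (hn : n ∈ meetSet l m l' m')
    (hn' : n' ∈ meetSet l m l' m') {a : GroupoidArrow Λ.BoundaryPath} (ha : a ∈ ZExt l m n)
    (ha' : a ∈ ZExt l m n') : n = n' := by
  obtain ⟨s, ⟨h₁, -, -, hd⟩, -⟩ := hn
  obtain ⟨s', ⟨h₁', -, -, hd'⟩, -⟩ := hn'
  have hZ := ZExt_subset _ _ _ ha
  obtain ⟨w, hw, -⟩ := mem_Z_iff.1 hZ
  rw [mem_ZExt_iff hZ hw] at ha ha'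
  exact comp_left_cancel
    (eq_of_mem_pre (hw.comp_mem ha) (hw.comp_mem ha') (hd.trans hd'.symm))

/-- Exhaustive `G` may be allowed: by the boundary condition the set is then empty. -/
theorem isOpen_ZDiff {l m : Λ.Path} (h : l.src = m.src) {G : Set Λ.Path} (hfin : G.Finite)
    (hG : ∀ n ∈ G, n.rng = l.src) : IsOpen (ZDiff l m G) := by
  by_cases hex : IsExhaustive l.src G
  · convert isOpen_empty
    refine Set.eq_empty_of_forall_notMem fun a ha => ?_
    obtain ⟨hZ, ha⟩ := mem_ZDiff_iff.1 ha
    obtain ⟨w, hw, -⟩ := mem_Z_iff.1 hZ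
    obtain ⟨e, he, h', h''⟩ := exists_mem_pre_of_isExhaustive hw.vert_mem hfin hG hex
    refine ha e he ((mem_ZExt_iff hZ hw).2 ?_)
    have e' : (vert l.src).comp e h' = e := by
      obtain ⟨_, _, _⟩ := e
      obtain rfl := hG _ he
      exact vert_comp _
    rwa [e'] at h''
  · exact TopologicalSpace.isOpen_generateFrom_of_mem ⟨l, m, G, h, hfin, hG, hex, rfl⟩

theorem ZDiff_empty (l m : Λ.Path) : ZDiff l m ∅ = Z l m := by
  ext a
  simp [mem_ZDiff_iff]

theorem Z_eq_empty {l m : Λ.Path} (h : l.src ≠ m.src) : Z l m = ∅ :=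
  Set.eq_empty_of_forall_notMem fun _ ha => h (src_eq_of_mem_Z ha)

theorem isOpen_Z (l m : Λ.Path) : IsOpen (Z l m) := by
  by_cases h : l.src = m.src
  · rw [← ZDiff_empty]
    exact isOpen_ZDiff h Set.finite_empty (by simp)
  · rw [Z_eq_empty h]
    exact isOpen_empty

variable [Λ.FinitelyAligned]

theorem finite_meetSet (l m l' m' : Λ.Path) : (meetSet l m l' m').Finite :=
  ((FinitelyAligned.finite_minExt l l').image Prod.fst).subset
    fun n ⟨s, h, _⟩ => ⟨(n, s), h, rfl⟩

/-- An arrow outside `Z l m` lies in some `Z l' m'`; removing from the latter the finitely many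
pieces of its intersection with `Z l m` leaves a neighbourhood of the arrow. -/
theorem isClosed_Z (l m : Λ.Path) : IsClosed (Z l m) := by
  by_cases h : l.src = m.src
  · rw [← isOpen_compl_iff, isOpen_iff_forall_mem_open]
    intro a ha
    obtain ⟨l', m', h', ha'⟩ := exists_mem_Z a
    refine ⟨ZDiff l' m' (meetSet l' m' l m), fun b hb hbZ => ?_,
      isOpen_ZDiff h' (finite_meetSet _ _ _ _) ?_, mem_ZDiff_iff.2 ⟨ha', fun n hn han => ?_⟩⟩
    · obtain ⟨hb1, hb2⟩ := mem_ZDiff_iff.1 hb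
      obtain ⟨n, hn, hbn⟩ := (mem_inter_iff_meetSet h' h).1 ⟨hb1, hbZ⟩
      exact hb2 n hn hbn
    · rintro n ⟨s, ⟨h₁, -⟩, -⟩
      exact h₁.symm
    · exact ha ((mem_inter_iff_meetSet h' h).2 ⟨n, hn, han⟩).2
  · rw [Z_eq_empty h]
    exact isClosed_empty

/-- An ultrafilter containing `Z(λ *_s μ)` determines a boundary path in `s(λ)∂Λ`. -/
theorem exists_boundaryPath_of_ultrafilter {l m : Λ.Path}
    {F : Ultrafilter (GroupoidArrow Λ.BoundaryPath)} (hF : Z l m ∈ F) :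
    ∃ w : Λ.BoundaryPath, ∀ n, n ∈ w.1.pre ↔ ZExt l m n ∈ F := by
  obtain ⟨w, hw⟩ := exists_pre_eq {n | ZExt l m n ∈ F}
    ⟨vert l.src, by rwa [Set.mem_ofPred_eq, ZExt_vert]⟩
    (fun n p hnp hp => Filter.mem_of_superset hp (ZExt_anti l m hnp)) (by
      intro n hn n' hn'
      -- The minimal common extensions of `n` and `n'`. There are finitely many, so the ultrafilter
      -- selects one of the corresponding pieces.
      let Q : Set Λ.Path := {q | n ≤ q ∧ n' ≤ q ∧ q.deg = n.deg ⊔ n'.deg ∧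
        ∃ p ∈ minExt n n', ∃ h, n.comp p.1 h = q}
      have hQ : Q.Finite := by
        classical
        refine ((FinitelyAligned.finite_minExt n n').image fun p =>
          if h : n.src = p.1.rng then n.comp p.1 h else n).subset ?_
        rintro q ⟨-, -, -, p, hp, h, hq⟩
        exact ⟨p, hp, by rw [← hq]; exact dif_pos h⟩
      have hsub : ZExt l m n ∩ ZExt l m n' ⊆ ⋃ q ∈ Q, ZExt l m q := by
        rintro a ⟨ha, ha'⟩
        have hZ := ZExt_subset _ _ _ ha
        obtain ⟨w, hw, -⟩ := mem_Z_iff.1 hZ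
        rw [mem_ZExt_iff hZ hw] at ha ha'
        obtain ⟨c, hc, h1, h2, -⟩ := exists_mem_pre_sup ha ha'
        obtain ⟨p, hp, h, hle⟩ := exists_mem_minExt h1 h2
        obtain ⟨h₁, h₂, e, hd⟩ := id hp
        exact Set.mem_biUnion (x := n.comp p.1 h)
          ⟨le_comp _ _ _, ⟨_, h₂, e.symm⟩, hd, p, hp, h, rfl⟩
          ((mem_ZExt_iff hZ hw).2 (mem_pre_of_le hle hc))
      obtain ⟨q, hq, hqF⟩ := (Ultrafilter.finite_biUnion_mem_iff hQ).1
        (Filter.mem_of_superset (Filter.inter_mem hn hn') hsub)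
      exact ⟨q, hqF, hq.1, hq.2.1⟩)
  refine ⟨⟨w, isBoundary_iff.2 ?_⟩, fun n => by rw [hw]; rfl⟩
  intro n hn E hE
  rw [hw] at hn ⊢
  have hsub : ZExt l m n ⊆ ⋃ e ∈ (E : Set Λ.Path), {a | ∃ h, a ∈ ZExt l m (n.comp e h)} := by
    intro a ha
    have hZ := ZExt_subset _ _ _ ha
    obtain ⟨w, hw, -⟩ := mem_Z_iff.1 hZ
    rw [mem_ZExt_iff hZ hw] at ha
    obtain ⟨e, he, h, h'⟩ := isBoundary_iff.1 w.2 n ha E hE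
    exact Set.mem_biUnion he ⟨h, (mem_ZExt_iff hZ hw).2 h'⟩
  obtain ⟨e, he, heF⟩ := (Ultrafilter.finite_biUnion_mem_iff E.finite_toSet).1
    (Filter.mem_of_superset hn hsub)
  exact ⟨e, he, ((hE.1 e he).1).symm, Filter.mem_of_superset heF fun a ⟨_, h⟩ => h⟩

/-- An ultrafilter on `Z l m` determines a boundary path `w`, and it converges to the arrow `(l w,
d(l) - d(m), m w)`. -/
theorem isCompact_Z (l m : Λ.Path) : IsCompact (Z l m) := by
  rw [isCompact_iff_ultrafilter_le_nhds]
  intro F hF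
  rw [Filter.le_principal_iff] at hF
  have hsrc : l.src = m.src := by
    obtain ⟨a, ha⟩ := F.nonempty_of_mem hF
    exact src_eq_of_mem_Z ha
  obtain ⟨w, hw⟩ := exists_boundaryPath_of_ultrafilter hF
  have hv : vert l.src ∈ w.1.pre := by rwa [hw, ZExt_vert]
  obtain ⟨x, hx⟩ := BoundaryPath.exists_extends hv
  obtain ⟨y, hy⟩ := BoundaryPath.exists_extends (l := m) (hsrc ▸ hv)
  have ha : extArrow hx hy ∈ Z l m := mem_Z_iff.2 ⟨w, hx, hy, rfl⟩
  have hax : Extends l w.1 (extArrow hx hy).rng.1 := hx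
  generalize extArrow hx hy = a at ha hax
  -- The ultrafilter and the limit arrow agree on all sets `Z`, hence on the basic open sets, which
  -- remove finitely many such sets from another.
  have key : ∀ l' m' : Λ.Path, l'.src = m'.src → (Z l' m' ∈ F ↔ a ∈ Z l' m') := by
    intro l' m' h'
    constructor
    · intro hZ
      have hsub : Z l m ∩ Z l' m' ⊆ ⋃ n ∈ meetSet l m l' m', ZExt l m n := fun b hb => by
        obtain ⟨n, hn, hbn⟩ := (mem_inter_iff_meetSet hsrc h').1 hb
        exact Set.mem_biUnion hn hbn
      obtain ⟨n, hn, hnF⟩ := (Ultrafilter.finite_biUnion_mem_iff (finite_meetSet _ _ _ _)).1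
        (Filter.mem_of_superset (Filter.inter_mem hF hZ) hsub)
      exact ((mem_inter_iff_meetSet hsrc h').2 ⟨n, hn, (mem_ZExt_iff ha hax).2 ((hw n).2 hnF)⟩).2
    · intro haZ
      obtain ⟨n, hn, han⟩ := (mem_inter_iff_meetSet hsrc h').1 ⟨ha, haZ⟩
      exact Filter.mem_of_superset ((hw n).1 ((mem_ZExt_iff ha hax).1 han)) fun b hb =>
        ((mem_inter_iff_meetSet hsrc h').2 ⟨n, hn, hb⟩).2
  refine ⟨a, ha, ?_⟩
  rw [TopologicalSpace.nhds_generateFrom]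
  refine le_iInf₂ fun U hU => Filter.le_principal_iff.2 ?_
  obtain ⟨haU, l', m', G, h', hGfin, hG, -, rfl⟩ := hU
  obtain ⟨haZ, haG⟩ := mem_ZDiff_iff.1 haU
  refine Filter.inter_mem ((key l' m' h').2 haZ) (Ultrafilter.compl_mem_iff_notMem.2 fun hmem => ?_)
  obtain ⟨n, hn, hnF⟩ := (Ultrafilter.finite_biUnion_mem_iff hGfin).1 hmem
  obtain ⟨b, e, e', -⟩ := F.nonempty_of_mem hnF
  refine haG n hn ⟨e, e', (key (l'.comp n e) (m'.comp n e') rfl).1 ?_⟩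
  exact Filter.mem_of_superset hnF fun c ⟨_, _, hc⟩ => hc

/-! ### The range of the representation -/

section Range

variable {R : Type w} [CommRing R]

theorem indicator_Z_mem_range (l m : Λ.Path) :
    (Z l m).indicator 1 ∈ LinearMap.range (toFun Λ R) := ⟨_, toFun_path_mul_ghost l m⟩

theorem indicator_ZExt_mem_range (l m n : Λ.Path) :
    (ZExt l m n).indicator 1 ∈ LinearMap.range (toFun Λ R) := by
  rcases ZExt_eq_or l m n with h | ⟨l', m', h⟩
  · rw [h, Set.indicator_empty']
    exact Submodule.zero_mem _
  · rw [h]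
    exact indicator_Z_mem_range _ _

theorem toFun_induction {p : (GroupoidArrow Λ.BoundaryPath → R) → Prop}
    (hZ : ∀ l m : Λ.Path, l.src = m.src → p ((Z l m).indicator 1)) (h0 : p 0)
    (hadd : ∀ f g, p f → p g → p (f + g)) (hsmul : ∀ (r : R) f, p f → p (r • f))
    (a : KumjianPask Λ R) : p (toFun Λ R a) := by
  have ha := Submodule.mem_top (R := R) (x := a)
  rw [← KumjianPask.span_path_mul_ghost Λ R] at ha
  induction ha using Submodule.span_induction with
  | mem a ha =>
    obtain ⟨⟨⟨l, m⟩, hlm⟩, rfl⟩ := ha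
    rw [toFun_path_mul_ghost]
    exact hZ l m hlm
  | zero => rwa [map_zero]
  | add a b _ _ h1 h2 => rw [map_add]; exact hadd _ _ h1 h2
  | smul r a _ h => rw [map_smul]; exact hsmul _ _ h

theorem indicator_mul_mem_range {l m l' m' : Λ.Path} (h : l.src = m.src) (h' : l'.src = m'.src) :
    (Z l m).indicator 1 * (Z l' m').indicator 1 ∈ LinearMap.range (toFun Λ R) := by
  have : (Z l m).indicator 1 * (Z l' m').indicator (1 : GroupoidArrow Λ.BoundaryPath → R) =
      ∑ n ∈ (finite_meetSet l m l' m').toFinset, (ZExt l m n).indicator 1 := by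
    funext a
    rw [← Set.inter_indicator_one, Finset.sum_apply]
    by_cases ha : a ∈ Z l m ∩ Z l' m'
    · obtain ⟨n, hn, han⟩ := (mem_inter_iff_meetSet h h').1 ha
      rw [Set.indicator_of_mem ha, Finset.sum_eq_single n, Set.indicator_of_mem han]
      · intro n' hn' hne
        rw [Set.Finite.mem_toFinset] at hn'
        exact Set.indicator_of_notMem (fun han' => hne (eq_of_mem_meetSet hn' hn han' han)) _
      · intro hn'
        rw [Set.Finite.mem_toFinset] at hn'
        exact (hn' hn).elim
    · rw [Set.indicator_of_notMem ha, Finset.sum_eq_zero]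
      intro n hn
      rw [Set.Finite.mem_toFinset] at hn
      exact Set.indicator_of_notMem
        (fun han => ha ((mem_inter_iff_meetSet h h').2 ⟨n, hn, han⟩)) _
  rw [this]
  exact Submodule.sum_mem _ fun n _ => indicator_ZExt_mem_range l m n

/-- The range of `toFun` is closed under pointwise products. -/
theorem mul_mem_range {f g : GroupoidArrow Λ.BoundaryPath → R}
    (hf : f ∈ LinearMap.range (toFun Λ R)) (hg : g ∈ LinearMap.range (toFun Λ R)) :
    f * g ∈ LinearMap.range (toFun Λ R) := by
  obtain ⟨a, rfl⟩ := hf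
  obtain ⟨b, rfl⟩ := hg
  refine toFun_induction (p := fun f => f * toFun Λ R b ∈ LinearMap.range (toFun Λ R))
    (fun l m h => ?_) (by rw [zero_mul]; exact Submodule.zero_mem _)
    (fun f g h1 h2 => by rw [add_mul]; exact Submodule.add_mem _ h1 h2)
    (fun r f h => by rw [smul_mul_assoc]; exact Submodule.smul_mem _ _ h) a
  exact toFun_induction
    (p := fun f => (Z l m).indicator 1 * f ∈ LinearMap.range (toFun Λ R))
    (fun l' m' h' => indicator_mul_mem_range h h') (by rw [mul_zero]; exact Submodule.zero_mem _)
    (fun f g h1 h2 => by rw [mul_add]; exact Submodule.add_mem _ h1 h2)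
    (fun r f h => by rw [mul_smul_comm]; exact Submodule.smul_mem _ _ h) b

theorem indicator_diff_mem_range {U V : Set (GroupoidArrow Λ.BoundaryPath)}
    (hU : U.indicator 1 ∈ LinearMap.range (toFun Λ R))
    (hV : V.indicator 1 ∈ LinearMap.range (toFun Λ R)) :
    (U \ V).indicator 1 ∈ LinearMap.range (toFun Λ R) := by
  have : (U \ V).indicator (1 : GroupoidArrow Λ.BoundaryPath → R) =
      U.indicator 1 - U.indicator 1 * V.indicator 1 := by
    classical
    funext a
    by_cases h1 : a ∈ U <;> by_cases h2 : a ∈ V <;> simp [h1, h2]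
  rw [this]
  exact Submodule.sub_mem _ hU (mul_mem_range hU hV)

theorem indicator_ZDiff_mem_range (l m : Λ.Path) {G : Set Λ.Path} (hG : G.Finite) :
    (ZDiff l m G).indicator 1 ∈ LinearMap.range (toFun Λ R) := by
  induction G, hG using Set.Finite.induction_on with
  | empty => rw [ZDiff_empty]; exact indicator_Z_mem_range _ _
  | @insert n G _ _ ih =>
    have : ZDiff l m (insert n G) = ZDiff l m G \ ZExt l m n := by
      ext a
      simp only [mem_ZDiff_iff, Set.mem_sdiff, Set.forall_mem_insert]
      tauto
    rw [this]
    exact indicator_diff_mem_range ih (indicator_ZExt_mem_range _ _ _)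

theorem exists_indicator_mem_range (R : Type w) [CommRing R] {a : GroupoidArrow Λ.BoundaryPath}
    {U : Set (GroupoidArrow Λ.BoundaryPath)} (hU : U ∈ 𝓝 a) :
    ∃ V ∈ 𝓝 a, V ⊆ U ∧ V.indicator 1 ∈ LinearMap.range (toFun Λ R) := by
  -- Neighbourhoods of `a` with indicator in the range are stable under intersection and include the
  -- basic ones, so they form a basis at `a`.
  let B : FilterBasis (GroupoidArrow Λ.BoundaryPath) :=
    { sets := {V | V ∈ 𝓝 a ∧ V.indicator 1 ∈ LinearMap.range (toFun Λ R)}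
      nonempty := by
        obtain ⟨l, m, -, ha⟩ := exists_mem_Z a
        exact ⟨Z l m, (isOpen_Z l m).mem_nhds ha, indicator_Z_mem_range l m⟩
      inter_sets := fun {V W} hV hW => ⟨V ∩ W, ⟨Filter.inter_mem hV.1 hW.1, by
        rw [Set.inter_indicator_one]
        exact mul_mem_range hV.2 hW.2⟩, subset_rfl⟩ }
  have hB : B.filter ≤ 𝓝 a := by
    rw [TopologicalSpace.nhds_generateFrom]
    refine le_iInf₂ fun V hV => Filter.le_principal_iff.2 (B.mem_filter_iff.2 ⟨V, ?_, subset_rfl⟩)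
    have hVo : IsOpen V := TopologicalSpace.isOpen_generateFrom_of_mem hV.2
    obtain ⟨haV, l, m, G, -, hG, -, -, rfl⟩ := hV
    exact ⟨hVo.mem_nhds haV, indicator_ZDiff_mem_range l m hG⟩
  obtain ⟨V, hV, hVU⟩ := B.mem_filter_iff.1 (hB hU)
  exact ⟨V, hV.1, hVU, hV.2⟩

theorem toFun_mem_steinbergAlgebra (a : KumjianPask Λ R) :
    toFun Λ R a ∈ steinbergAlgebra Λ.BoundaryPath R := by
  refine toFun_induction (p := fun f => f ∈ steinbergAlgebra Λ.BoundaryPath R)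
    (fun l m h => ?_) (Submodule.zero_mem _) (fun f g h1 h2 => Submodule.add_mem _ h1 h2)
    (fun r f h => Submodule.smul_mem _ _ h) a
  refine ⟨?_, HasCompactSupport.intro' (isCompact_Z l m) (isClosed_Z l m) fun a ha =>
    Set.indicator_of_notMem ha _⟩
  rw [IsLocallyConstant.iff_eventually_eq]
  intro a
  by_cases ha : a ∈ Z l m
  · filter_upwards [(isOpen_Z l m).mem_nhds ha] with b hb
    rw [Set.indicator_of_mem ha, Set.indicator_of_mem hb]
    rfl
  · filter_upwards [(isClosed_Z l m).isOpen_compl.mem_nhds ha] with b hb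
    rw [Set.indicator_of_notMem ha, Set.indicator_of_notMem hb]

variable (Λ R) in
theorem range_toFun : LinearMap.range (toFun Λ R) = steinbergAlgebra Λ.BoundaryPath R := by
  apply le_antisymm
  · rintro _ ⟨a, rfl⟩
    exact toFun_mem_steinbergAlgebra a
  · rintro f ⟨hf, hc⟩
    -- Carrying the indicator of `V` along lets inclusion-exclusion handle overlapping unions in the
    -- compactness induction.
    have key : ∃ V, tsupport f ⊆ V ∧ V.indicator 1 ∈ LinearMap.range (toFun Λ R) ∧
        V.indicator f ∈ LinearMap.range (toFun Λ R) := by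
      refine IsCompact.induction_on (p := fun s => ∃ V, s ⊆ V ∧
        V.indicator 1 ∈ LinearMap.range (toFun Λ R) ∧
        V.indicator f ∈ LinearMap.range (toFun Λ R)) hc ?_ ?_ ?_ ?_
      · refine ⟨∅, subset_rfl, ?_, ?_⟩ <;> rw [Set.indicator_empty'] <;> exact Submodule.zero_mem _
      · rintro s t hst ⟨V, hV, h⟩
        exact ⟨V, hst.trans hV, h⟩
      · rintro s t ⟨V, hV, h1, h2⟩ ⟨W, hW, h3, h4⟩
        refine ⟨V ∪ W, Set.union_subset_union hV hW, ?_, ?_⟩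
        · have : (V ∪ W).indicator (1 : GroupoidArrow Λ.BoundaryPath → R) =
              V.indicator 1 + W.indicator 1 - V.indicator 1 * W.indicator 1 := by
            classical
            funext a
            by_cases h1 : a ∈ V <;> by_cases h2 : a ∈ W <;> simp [h1, h2]
          rw [this]
          exact Submodule.sub_mem _ (Submodule.add_mem _ h1 h3) (mul_mem_range h1 h3)
        · have : (V ∪ W).indicator f =
              V.indicator f + W.indicator f - V.indicator 1 * W.indicator f := by
            classical
            funext a
            by_cases h1 : a ∈ V <;> by_cases h2 : a ∈ W <;> simp [h1, h2]
          rw [this]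
          exact Submodule.sub_mem _ (Submodule.add_mem _ h2 h4) (mul_mem_range h1 h4)
      · intro a _
        obtain ⟨V, hV, hVf, hVR⟩ := exists_indicator_mem_range R (hf.eventually_eq a)
        refine ⟨V, mem_nhdsWithin_of_mem_nhds hV, V, subset_rfl, hVR, ?_⟩
        have : V.indicator f = f a • V.indicator (1 : GroupoidArrow Λ.BoundaryPath → R) := by
          classical
          funext b
          by_cases hb : b ∈ V
          · have : f b = f a := hVf hb
            simp [hb, this]
          · simp [hb]
        rw [this]
        exact Submodule.smul_mem _ _ hVR
    obtain ⟨V, hV, -, h⟩ := key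
    rwa [Set.indicator_eq_self.2 ((subset_tsupport f).trans hV)] at h

end Range

end KGraph

end

theorem mainTheorem5 {k : ℕ} (hk : 0 < k) (Λ : KGraph.{u, v} k) [Λ.FinitelyAligned]
    (R : Type w) [CommRing R] :
    (∀ f ∈ steinbergAlgebra Λ.BoundaryPath R, ∀ g ∈ steinbergAlgebra Λ.BoundaryPath R,
      (∀ a, (Function.support (convTerm f g a)).Finite) ∧
        convolution f g ∈ steinbergAlgebra Λ.BoundaryPath R) ∧
    ∃ π : KGraph.KumjianPask Λ R ≃ₗ[R] steinbergAlgebra Λ.BoundaryPath R,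
      (∀ x y, (π (x * y) : GroupoidArrow Λ.BoundaryPath → R) = convolution (π x) (π y)) ∧
      (∀ l : Λ.Path, (π (KGraph.KumjianPask.path R l) : GroupoidArrow Λ.BoundaryPath → R) =
        (KGraph.Z l (KGraph.vert l.src)).indicator 1) ∧
      (∀ m : Λ.Path, (π (KGraph.KumjianPask.ghost R m) : GroupoidArrow Λ.BoundaryPath → R) =
        (KGraph.Z (KGraph.vert m.src) m).indicator 1) := by
  constructor
  · intro f hf g hg
    -- Functions in the Steinberg algebra are kernels, and their convolution is the kernel of a
    -- product.
    rw [← KGraph.range_toFun Λ R] at hf hg ⊢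
    obtain ⟨a, rfl⟩ := hf
    obtain ⟨b, rfl⟩ := hg
    exact ⟨fun c => (KGraph.convTerm_toFun a b c).1,
      a * b, funext fun c => (KGraph.convTerm_toFun a b c).2⟩
  · refine ⟨(LinearEquiv.ofInjective _ (KGraph.toFun_injective Λ R)).trans
      (LinearEquiv.ofEq _ _ (KGraph.range_toFun Λ R)), fun x y => ?_, fun l => ?_, fun m => ?_⟩
    · exact funext fun c => (KGraph.convTerm_toFun x y c).2
    · exact KGraph.toFun_path l
    · exact KGraph.toFun_ghost m
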